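/- Let $n\ge 2$ and let $c_0>0$, $\beta>1/3$, $\alpha_p>0$, $\gamma>1$, $D_{\mathrm{Th}}>0$ be fixed constants. For $\nu_0>0$ consider the Cauchy problem for the thermoviscous acoustic system $$\begin{cases}\phi_{tt}-c_0^2\Delta\phi-(1+\beta)\nu_0\Delta\phi_t+\alpha_pc_0^2T_t=0,\\[2pt] T_t-\gamma D_{\mathrm{Th}}\Delta T+\dfrac{\gamma-1}{\alpha_p}\Delta\phi=0,\end{cases}\qquad x\in\mathbb R^n,\ t>0,$$ $$\phi(0,\cdot)=\phi_0,\quad \phi_t(0,\cdot)=\phi_1,\quad T(0,\cdot)=T_0,$$ and the thermoelastic system, which is the same Cauchy problem with $\nu_0=0$ and the same initial data. Here $(\phi,T)$ is a solution if $\phi,\phi_t,T\in C([0,\infty),L^2(\mathbb R^n))$, $\phi_t$ is the derivative of $\phi$ in $L^2$ for $t>0$, the initial conditions hold, and for every $t>0$ the equations hold in the sense of tempered distributions (time derivatives being taken after testing with Schwartz functions of $x$). Write $\langle D\rangle^r=(1-\Delta)^{r/2}$. Let $s>n+2$. Then there is a constant $C>0$, independent of $\nu_0$ and of the initial data, such that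 the following holds. Suppose $\langle D\rangle^{s+3}\phi_0,\ \langle D\rangle^{s+2}\phi_1,\ \langle D\rangle^{s+2}T_0\in L^1(\mathbb R^n)$, let $\nu_0>0$, let $(\phi,T)$ be a solution of the thermoviscous system and $(\phi^{(0)},T^{(0)})$ a solution of the thermoelastic system, both with initial data $(\phi_0,\phi_1,T_0)$. Then $$\sup_{t\in[0,\infty)}\Big(\|\phi_t-\phi_t^{(0)}\|_{L^\infty}+\|\Delta\phi-\Delta\phi^{(0)}\|_{L^\infty}+\|T-T^{(0)}\|_{L^\infty}\Big)\le C\sqrt{\nu_0}\,\Big(\|\langle D\rangle^{s+2}\langle D\rangle\phi_0\|_{L^1}+\|\langle D\rangle^{s+2}\phi_1\|_{L^1}+\|\langle D\rangle^{s+2}T_0\|_{L^1}\Big),$$ $$\sup_{t\in[0,\infty)}\|\phi-\phi^{(0)}\|_{L^\infty}\le C\sqrt{\nu_0}\,\Big(\|\langle D\rangle^{s}\langle D\rangle\phi_0\|_{L^1}+\|\langle D\rangle^{s}\phi_1\|_{L^1}+\|\langle D\rangle^{s}T_0\|_{L^1}\Big),$$ where the differences on the left are taken at time $t$. In particular $(\phi_t,\Delta\phi,T)\to(\phi^{(0)}_t,\Delta\phi^{(0)},T^{(0)})$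 and $\phi\to\phi^{(0)}$ in $L^\infty([0,\infty)\times\mathbb R^n)$ with rate $\sqrt{\nu_0}$ as $\nu_0\downarrow0$. -/

import Mathlib

open MeasureTheory
open scoped ENNReal SchwartzMap FourierTransform Laplacian

namespace ThermoAcoustic

/-- The Euclidean space `ℝⁿ`. -/
abbrev Space (n : ℕ) : Type := EuclideanSpace ℝ (Fin n)

/-- The Lebesgue space `L²(ℝⁿ)` of complex-valued (in particular, real-valued) functions. -/
abbrev L2 (n : ℕ) : Type := Lp ℂ 2 (volume : Measure (Space n))

/-- The physical constants other than the momentum diffusion constant `ν₀`: the isothermal speed of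
sound `c₀`, the viscosity ratio `β = ηᵇ/ηˢ + 1/3`, the isobaric thermal expansion coefficient `αₚ`,
the ratio of specific heats `γ` and the thermal diffusion constant `D_Th`. -/
structure Medium where
  c₀ : ℝ
  β : ℝ
  αp : ℝ
  γ : ℝ
  Dth : ℝ
  c₀_pos : 0 < c₀
  β_gt : 1 / 3 < β
  αp_pos : 0 < αp
  γ_gt : 1 < γ
  Dth_pos : 0 < Dth

variable {n : ℕ}

/-- The symbol `⟨ξ⟩ʳ = (1 + |ξ|²)^{r/2}`, written in the frequency variable of Mathlib's Fourier
transform, whose kernel is `exp (-2πi⟨x, ξ⟩)`; hence the factor `2π`. -/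
noncomputable def japaneseSymbol (n : ℕ) (r : ℝ) (ξ : Space n) : ℂ :=
  (((1 + ‖(2 * Real.pi) • ξ‖ ^ 2) ^ (r / 2) : ℝ) : ℂ)

theorem japaneseSymbol_hasTemperateGrowth (n : ℕ) (r : ℝ) :
    (japaneseSymbol n r).HasTemperateGrowth := by
  have h : (fun x : Space n => (1 + ‖x‖ ^ 2) ^ (r / 2)).HasTemperateGrowth := by fun_prop
  have h2 : (fun ξ : Space n => (2 * Real.pi) • ξ).HasTemperateGrowth := by fun_prop
  have h3 := h.comp h2
  have h4 : (fun ξ : Space n =>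
      (((1 + ‖(2 * Real.pi) • ξ‖ ^ 2) ^ (r / 2) : ℝ) : ℂ)).HasTemperateGrowth :=
    Function.HasTemperateGrowth.comp (g := Complex.ofReal) (by fun_prop) h3
  exact h4

/-- The pseudo-differential operator `⟨D⟩ʳ = (1 - Δ)^{r/2}` on tempered distributions. -/
noncomputable def japaneseD (r : ℝ) : 𝓢'(Space n, ℂ) →L[ℂ] 𝓢'(Space n, ℂ) :=
  TemperedDistribution.fourierMultiplierCLM ℂ (japaneseSymbol n r)

/-- The tempered distribution `u` is (represented by) an `Lᵖ` function. -/
def IsLp (p : ℝ≥0∞) [Fact (1 ≤ p)] (u : 𝓢'(Space n, ℂ)) : Prop :=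
  ∃ f : Lp ℂ p (volume : Measure (Space n)), (f : 𝓢'(Space n, ℂ)) = u

/-- The `Lᵖ` norm of a tempered distribution: the `Lᵖ` norm of the function representing it, and
`∞` if it is not represented by an `Lᵖ` function. -/
noncomputable def distNorm (p : ℝ≥0∞) [Fact (1 ≤ p)] (u : 𝓢'(Space n, ℂ)) : ℝ≥0∞ :=
  ⨅ (f : Lp ℂ p (volume : Measure (Space n))) (_ : (f : 𝓢'(Space n, ℂ)) = u), ‖f‖ₑ

/-- `u'` is the time derivative at `t` of the curve `u` of tempered distributions, tested against
Schwartz functions in the space variable. -/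
def HasTimeDerivAt (u : ℝ → 𝓢'(Space n, ℂ)) (u' : 𝓢'(Space n, ℂ)) (t : ℝ) : Prop :=
  ∀ χ : 𝓢(Space n, ℂ), HasDerivAt (fun τ => u τ χ) (u' χ) t

/-- `(φ, T)`, with time derivative `φt` of `φ`, solves the Cauchy problem
`φ_tt - c₀² Δφ - (1 + β) ν Δφ_t + αₚ c₀² T_t = 0`,
`T_t - γ D_Th ΔT + ((γ - 1) / αₚ) Δφ = 0` for `t > 0`,
`φ(0) = φ₀`, `φ_t(0) = φ₁`, `T(0) = T₀`,
with `φ ∈ C([0,∞), L²) ∩ C¹((0,∞), L²)`, `φ_t ∈ C([0,∞), L²)`, `T ∈ C([0,∞), L²)`, the equations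
being understood in the sense of tempered distributions. For `ν > 0` this is the thermoviscous
system, for `ν = 0` the thermoelastic one. -/
structure IsSolution (m : Medium) (ν : ℝ) (φ₀ φ₁ T₀ : 𝓢'(Space n, ℂ))
    (φ φt T : ℝ → L2 n) : Prop where
  continuousOn_φ : ContinuousOn φ (Set.Ici 0)
  continuousOn_φt : ContinuousOn φt (Set.Ici 0)
  continuousOn_T : ContinuousOn T (Set.Ici 0)
  init_φ : (φ 0 : 𝓢'(Space n, ℂ)) = φ₀
  init_φt : (φt 0 : 𝓢'(Space n, ℂ)) = φ₁
  init_T : (T 0 : 𝓢'(Space n, ℂ)) = T₀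
  hasDerivAt_φ : ∀ t : ℝ, 0 < t → HasDerivAt φ (φt t) t
  equations : ∀ t : ℝ, 0 < t → ∃ φtt Tt : 𝓢'(Space n, ℂ),
    HasTimeDerivAt (fun τ => (φt τ : 𝓢'(Space n, ℂ))) φtt t ∧
    HasTimeDerivAt (fun τ => (T τ : 𝓢'(Space n, ℂ))) Tt t ∧
    φtt - (m.c₀ ^ 2) • Δ (φ t : 𝓢'(Space n, ℂ))
      - ((1 + m.β) * ν) • Δ (φt t : 𝓢'(Space n, ℂ)) + (m.αp * m.c₀ ^ 2) • Tt = 0 ∧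
    Tt - (m.γ * m.Dth) • Δ (T t : 𝓢'(Space n, ℂ))
      + ((m.γ - 1) / m.αp) • Δ (φ t : 𝓢'(Space n, ℂ)) = 0

end ThermoAcoustic

namespace ThermoAcoustic

open Filter Topology

variable {n : ℕ}

/-! On the Fourier side each frequency, with `K` the symbol of `-Δ`, carries a linear ODE for the
coefficients `(u, v, θ)` of `(φ, φ_t, T)`. The unknown `g = a u - D θ`, with `a = (γ-1)/αₚ` and `D =
γ D_Th`, satisfies `θ' = K g`. With `κ = αₚ c₀²/a` the thermoelastic energy `v² + c₀² K u² + κ K g²`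
has derivative `-2 κ D K² g²`: only `g` is damped.

The viscous deviation, with zero data, is forced by `-δ K v`, where `δ = (1+β) ν₀` and `v` belongs
to the inviscid mode. Its energy grows at rate at most `δ K v²/2`, so `∫ K v² dt` must be bounded by
the initial energy. A multiplier `K (v u - p g v)` added to `M (1+K)` times the energy transfers the
damping of `g` to `v`. The result (`mode_energy_le`) is a deviation energy of at most a constant
times `ν₀ (1+K)` times the initial energy, uniformly in time; its square root is the rate `√ν₀`.

The `L^∞` norm is at most the `L¹` norm of the Fourier transform, and `L¹` bounds on the data give
pointwise decay of their transforms. All transforms are thus dominated by `√ν₀ ‖ξ‖⁻¹ ⟨ξ⟩^(2-s)`,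
integrable for `n ≥ 2` and `s > n + 2` (`integrable_weight`). Solutions being weak,
`IsSolution.exists_isMode` first shows that almost every Fourier coefficient follows the ODE. -/

/-! ### Energy estimate at a single frequency. -/

/-- By Young's inequality the multiplier is dominated by the weighted energy, so the functional `J`
of `mode_energy_le` lies between `0` and `2 M (1+K)` times the energy. -/
theorem abs_cross_term_le {c κ p K M u v g : ℝ} (hp : 0 < p) (hK : 0 ≤ K)
    (hM₂ : (p + 1) / 2 ≤ M) (hM₃ : p / 2 ≤ M * κ) (hM₄ : 1 / 2 ≤ M * c ^ 2) :
    |K * (v * u - p * (g * v))| ≤ M * (1 + K) * (v ^ 2 + c ^ 2 * K * u ^ 2 + κ * K * g ^ 2) := by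
  have young : ∀ x, |x * v * K| ≤ (1 + K) * (v ^ 2 + K * x ^ 2) / 2 := by
    intro x
    have h1 := mul_nonneg hK (sq_nonneg v)
    have h2 := mul_nonneg hK (sq_nonneg x)
    rw [abs_le]
    constructor
    · linarith [sq_nonneg (v + K * x)]
    · linarith [sq_nonneg (v - K * x)]
  have h3 : |K * (v * u - p * (g * v))| ≤ |u * v * K| + p * |g * v * K| := by
    rw [show K * (v * u - p * (g * v)) = u * v * K - p * (g * v * K) by ring]
    refine (abs_sub _ _).trans ?_
    rw [abs_mul p, abs_of_pos hp]
  have h6 : (v ^ 2 + K * u ^ 2) / 2 + p * ((v ^ 2 + K * g ^ 2) / 2)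
      ≤ M * (v ^ 2 + c ^ 2 * K * u ^ 2 + κ * K * g ^ 2) := by
    linarith [mul_le_mul_of_nonneg_right hM₂ (sq_nonneg v),
      mul_le_mul_of_nonneg_right hM₃ (mul_nonneg hK (sq_nonneg g)),
      mul_le_mul_of_nonneg_right hM₄ (mul_nonneg hK (sq_nonneg u))]
  have h7 := mul_le_mul_of_nonneg_left h6 (by positivity : 0 ≤ 1 + K)
  have h8 := mul_le_mul_of_nonneg_left (young g) hp.le
  linarith [young u]

/-- Along an inviscid mode the left side is the derivative of `J` in `mode_energy_le`. Young's
inequality spends `v²/2` and all of `c² K u²` on the cross terms. The remaining `g²` terms have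
orders `K²` and `K³`, hence the weight `1 + K` on the dissipation. -/
theorem multiplier_derivative_le {c α κ D p K M u v g : ℝ} (hp : 0 < p) (hK : 0 ≤ K) (hα : 0 < α)
    (hM₁ : p ^ 2 * D ^ 2 / 2 + (p - α) ^ 2 * c ^ 2 / 4 + p * α * c ^ 2 ≤ 2 * M * κ * D) :
    M * (1 + K) * (-(2 * κ * D * K ^ 2 * g ^ 2)) + K * (- v ^ 2 - c ^ 2 * K * u ^ 2
          + p * D * K * g * v + (p - α) * c ^ 2 * K * g * u + p * α * c ^ 2 * K * g ^ 2)
      ≤ -(K * v ^ 2 / 2) := by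
  have i1 : p * D * K * g * v ≤ v ^ 2 / 2 + p ^ 2 * D ^ 2 / 2 * K ^ 2 * g ^ 2 := by
    linarith [sq_nonneg (v - p * D * K * g)]
  have i2 : (p - α) * c ^ 2 * K * g * u
      ≤ c ^ 2 * K * u ^ 2 + (p - α) ^ 2 * c ^ 2 / 4 * K * g ^ 2 := by
    have := mul_nonneg (mul_nonneg (sq_nonneg c) hK) (sq_nonneg (u - (p - α) / 2 * g))
    linarith
  have i3 : (p ^ 2 * D ^ 2 / 2 * K + (p - α) ^ 2 * c ^ 2 / 4 + p * α * c ^ 2) * (K * g ^ 2)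
      ≤ (2 * M * κ * D * (1 + K)) * (K * g ^ 2) := by
    refine mul_le_mul_of_nonneg_right ?_ (by positivity)
    have : 0 ≤ p ^ 2 * D ^ 2 / 2 + ((p - α) ^ 2 * c ^ 2 / 4 + p * α * c ^ 2) * K := by
      positivity
    linarith [mul_le_mul_of_nonneg_right hM₁ (by positivity : 0 ≤ 1 + K)]
  have := mul_le_mul_of_nonneg_left (add_le_add (add_le_add i1 i2) i3) hK
  linarith

/-- Energy estimate for a single Fourier mode (real amplitudes), written in the unknowns in which the
dissipation is diagonal: `(u, v, g)` is the inviscid mode and `(w, y, h)` the deviation of the viscous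
mode from it. -/
theorem mode_energy_le {c α a D δ K M : ℝ} (hα : 0 < α) (ha : 0 < a) (hδ : 0 ≤ δ) (hK : 0 ≤ K)
    (hM₁ : (2 / a) ^ 2 * D ^ 2 / 2 + (2 / a - α) ^ 2 * c ^ 2 / 4 + 2 / a * α * c ^ 2
      ≤ 2 * M * (α * c ^ 2 / a) * D)
    (hM₂ : (2 / a + 1) / 2 ≤ M) (hM₃ : 2 / a / 2 ≤ M * (α * c ^ 2 / a))
    (hM₄ : 1 / 2 ≤ M * c ^ 2)
    (hc : 0 < c) {u v g w y h : ℝ → ℝ}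
    (hD : 0 < D)
    (hu : ∀ t, HasDerivAt u (v t) t)
    (hv : ∀ t, HasDerivAt v (-(c ^ 2 * K * (u t + α * g t))) t)
    (hg : ∀ t, HasDerivAt g (a * v t - D * K * g t) t)
    (hw : ∀ t, HasDerivAt w (y t) t)
    (hy : ∀ t, HasDerivAt y (-(c ^ 2 * K * (w t + α * h t)) - δ * K * (y t + v t)) t)
    (hh : ∀ t, HasDerivAt h (a * y t - D * K * h t) t)
    (hw₀ : w 0 = 0) (hy₀ : y 0 = 0) (hh₀ : h 0 = 0) {t : ℝ} (ht : 0 ≤ t) :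
    y t ^ 2 + c ^ 2 * K * w t ^ 2 + α * c ^ 2 / a * K * h t ^ 2
      ≤ δ * (2 * M) * (1 + K) *
        (v 0 ^ 2 + c ^ 2 * K * u 0 ^ 2 + α * c ^ 2 / a * K * g 0 ^ 2) := by
  set p := 2 / a with hp
  set κ := α * c ^ 2 / a with hκ
  have hpa : p * a = 2 := by rw [hp]; field_simp
  have hκa : κ * a = α * c ^ 2 := by rw [hκ]; field_simp
  have hp0 : 0 < p := by positivity
  have hκ0 : 0 < κ := by positivity
  have hM0 : 0 < M := by linarith [div_pos (add_pos hp0 one_pos) (two_pos : (0 : ℝ) < 2)]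
  let E : ℝ → ℝ := fun t => v t ^ 2 + c ^ 2 * K * u t ^ 2 + κ * K * g t ^ 2
  -- `J` decreases at rate at least `K v²/2` along the inviscid mode, which pays for the viscous
  -- forcing in `F`.
  let J : ℝ → ℝ := fun t => M * (1 + K) * E t + K * (v t * u t - p * (g t * v t))
  let F : ℝ → ℝ := fun t => y t ^ 2 + c ^ 2 * K * w t ^ 2 + κ * K * h t ^ 2 + δ * J t
  have hcross : ∀ t, |K * (v t * u t - p * (g t * v t))| ≤ M * (1 + K) * E t := by
    exact fun t => abs_cross_term_le hp0 hK hM₂ hM₃ hM₄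
  have hF : ∀ t, HasDerivAt F
      (2 * y t * (-(c ^ 2 * K * (w t + α * h t)) - δ * K * (y t + v t))
        + c ^ 2 * K * (2 * w t * y t) + κ * K * (2 * h t * (a * y t - D * K * h t))
        + δ * (M * (1 + K) * (2 * v t * (-(c ^ 2 * K * (u t + α * g t)))
          + c ^ 2 * K * (2 * u t * v t) + κ * K * (2 * g t * (a * v t - D * K * g t)))
        + K * ((-(c ^ 2 * K * (u t + α * g t))) * u t + v t * v t
          - p * ((a * v t - D * K * g t) * v t + g t * (-(c ^ 2 * K * (u t + α * g t)))))) ) t := by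
    intro t
    have sq : ∀ {f : ℝ → ℝ} {f' : ℝ}, HasDerivAt f f' t →
        HasDerivAt (fun s => f s ^ 2) (2 * f t * f') t := by
      intro f f' hf
      simpa using hf.fun_pow 2
    have hE := ((sq (hv t)).add ((sq (hu t)).const_mul (c ^ 2 * K))).add
      ((sq (hg t)).const_mul (κ * K))
    have hX := ((((hv t).mul (hu t)).sub (((hg t).mul (hv t)).const_mul p)).const_mul K)
    have hJ := (hE.const_mul (M * (1 + K))).add hX
    exact (((sq (hy t)).add ((sq (hw t)).const_mul (c ^ 2 * K))).add
      ((sq (hh t)).const_mul (κ * K))).add (hJ.const_mul δ)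
  have hdec : Antitone F := by
    refine antitone_of_deriv_nonpos (fun t => (hF t).differentiableAt) fun t => ?_
    rw [(hF t).deriv]
    -- The choice of `κ` with `κ a = α c²` cancels the coupling between the wave and thermal parts,
    -- here and in `e2`.
    have e1 : 2 * y t * (-(c ^ 2 * K * (w t + α * h t)) - δ * K * (y t + v t))
        + c ^ 2 * K * (2 * w t * y t) + κ * K * (2 * h t * (a * y t - D * K * h t))
        = -(2 * δ * K * (y t ^ 2 + y t * v t)) - 2 * κ * D * K ^ 2 * h t ^ 2 := by
      linear_combination (2 * K * h t * y t) * hκa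
    have e2 : 2 * v t * (-(c ^ 2 * K * (u t + α * g t)))
          + c ^ 2 * K * (2 * u t * v t) + κ * K * (2 * g t * (a * v t - D * K * g t))
        = - (2 * κ * D * K ^ 2 * g t ^ 2) := by
      linear_combination (2 * K * g t * v t) * hκa
    -- Since `p a = 2`, the term `-p a v²` from `-p (g v)'` turns the `+v²` of `(v u)'` into `-v²`.
    have e3 : (-(c ^ 2 * K * (u t + α * g t))) * u t + v t * v t
          - p * ((a * v t - D * K * g t) * v t + g t * (-(c ^ 2 * K * (u t + α * g t))))
        = - v t ^ 2 - c ^ 2 * K * u t ^ 2 + p * D * K * g t * v t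
          + (p - α) * c ^ 2 * K * g t * u t + p * α * c ^ 2 * K * g t ^ 2 := by
      linear_combination (- v t ^ 2) * hpa
    rw [e1, e2, e3]
    have i4 := multiplier_derivative_le (u := u t) (v := v t) (g := g t) hp0 hK hα hM₁
    -- Completing the square, `-2 (y² + y v) = -(2 y + v)²/2 + v²/2`; the last term is absorbed by
    -- `δ J'`.
    have i5 := mul_le_mul_of_nonneg_left i4 hδ
    have i6 := mul_nonneg (mul_nonneg hδ hK) (sq_nonneg (2 * y t + v t))
    have i7 : 0 ≤ 2 * κ * D * K ^ 2 * h t ^ 2 := by positivity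
    linarith
  have h0 := hdec ht
  have hJ0 : J 0 ≤ 2 * M * (1 + K) * E 0 := by
    have := (abs_le.1 (hcross 0)).2
    simp only [J]
    linarith
  have hJt : 0 ≤ δ * J t := by
    refine mul_nonneg hδ ?_
    have := (abs_le.1 (hcross t)).1
    simp only [J]
    linarith
  have hF0 : F 0 = δ * J 0 := by simp [F, hw₀, hy₀, hh₀]
  have hFt : F t = y t ^ 2 + c ^ 2 * K * w t ^ 2 + κ * K * h t ^ 2 + δ * J t := rfl
  have h1 := mul_le_mul_of_nonneg_left hJ0 hδ
  simp only [E] at h1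
  linarith

/-- `(u, v, θ)` solves the ordinary differential equations satisfied by the Fourier coefficients of
`(φ, φ_t, T)` at a frequency where the symbol of `-Δ` equals `K`. -/
structure IsMode (m : Medium) (ν K : ℝ) (u v θ : ℝ → ℂ) : Prop where
  hasDerivAt_u : ∀ t, HasDerivAt u (v t) t
  hasDerivAt_v : ∀ t, HasDerivAt v (-(m.c₀ ^ 2 * K) • u t - ((1 + m.β) * ν * K) • v t
    - (m.αp * m.c₀ ^ 2) • (((m.γ - 1) / m.αp * K) • u t - (m.γ * m.Dth * K) • θ t)) t
  hasDerivAt_θ : ∀ t, HasDerivAt θ (((m.γ - 1) / m.αp * K) • u t - (m.γ * m.Dth * K) • θ t) t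

/-- The mode equations have real coefficients, so a real functional `ℓ` reduces complex modes to
`mode_energy_le`. The constants `C₁` and `C₂` compare the energy in `g` with the one in `θ`, in both
directions. -/
theorem IsMode.sub_sq_le_of_functional (m : Medium) :
    ∃ C : ℝ, 0 < C ∧ ∀ (ℓ : ℂ →L[ℝ] ℝ) (ν K : ℝ), 0 ≤ ν → 0 ≤ K → ∀ u v θ u' v' θ' : ℝ → ℂ,
      IsMode m ν K u v θ → IsMode m 0 K u' v' θ' → u 0 = u' 0 → v 0 = v' 0 → θ 0 = θ' 0 →
      ∀ t, 0 ≤ t →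
      ℓ (v t - v' t) ^ 2 + K * ℓ (u t - u' t) ^ 2 + K * ℓ (θ t - θ' t) ^ 2
        ≤ C * ν * (1 + K) * (ℓ (v' 0) ^ 2 + K * ℓ (u' 0) ^ 2 + K * ℓ (θ' 0) ^ 2) := by
  have hc := m.c₀_pos
  have hβ := m.β_gt
  have hα := m.αp_pos
  have hγ := m.γ_gt
  have hD' := m.Dth_pos
  set c := m.c₀ with hcdef
  set β := m.β with hβdef
  set α := m.αp with hαdef
  set D := m.γ * m.Dth with hDdef
  set a := (m.γ - 1) / α with hadef
  have hD : 0 < D := mul_pos (by linarith) hD'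
  have ha : 0 < a := div_pos (by linarith) hα
  set κ := α * c ^ 2 / a with hκdef
  have hκ : 0 < κ := by positivity
  set p := 2 / a with hp
  have hp0 : 0 < p := by positivity
  have hβ' : 0 < 1 + β := by linarith
  obtain ⟨M, hM₁, hM₂, hM₃, hM₄⟩ : ∃ M : ℝ,
      p ^ 2 * D ^ 2 / 2 + (p - α) ^ 2 * c ^ 2 / 4 + p * α * c ^ 2 ≤ 2 * M * κ * D ∧
      (p + 1) / 2 ≤ M ∧ p / 2 ≤ M * κ ∧ 1 / 2 ≤ M * c ^ 2 := by
    set M₁ := (p ^ 2 * D ^ 2 / 2 + (p - α) ^ 2 * c ^ 2 / 4 + p * α * c ^ 2) / (2 * κ * D) with h₁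
    refine ⟨max (max M₁ ((p + 1) / 2)) (max (p / 2 / κ) (1 / 2 / c ^ 2)), ?_, ?_, ?_, ?_⟩
    · have := (le_max_left M₁ ((p + 1) / 2)).trans (le_max_left _ (max (p / 2 / κ) (1 / 2 / c ^ 2)))
      rw [h₁, div_le_iff₀ (by positivity)] at this
      linarith
    · exact (le_max_right M₁ ((p + 1) / 2)).trans (le_max_left _ _)
    · rw [← div_le_iff₀ hκ]
      exact (le_max_left (p / 2 / κ) _).trans (le_max_right _ _)
    · rw [← div_le_iff₀ (by positivity)]
      exact (le_max_right (p / 2 / κ) _).trans (le_max_right _ _)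
  have hM0 : 0 < M := by linarith
  set C₁ := 1 + (1 + 2 * a ^ 2 / D ^ 2) / c ^ 2 + 2 / D ^ 2 / κ with hC₁
  set C₂ := 1 + c ^ 2 + 2 * κ * a ^ 2 + 2 * κ * D ^ 2 with hC₂
  have hC₁0 : 0 < C₁ := by positivity
  have hC₂0 : 0 < C₂ := by positivity
  refine ⟨C₁ * (1 + β) * (2 * M) * C₂, by positivity, ?_⟩
  intro ℓ ν K hν hK u v θ u' v' θ' h h' hu0 hv0 hθ0 t ht
  have key := mode_energy_le (c := c) (α := α) (a := a) (D := D) (δ := (1 + β) * ν) (K := K)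
    (M := M) hα ha (by positivity) hK hM₁ hM₂ hM₃ hM₄ hc
    (u := fun t => ℓ (u' t)) (v := fun t => ℓ (v' t)) (g := fun t => a * ℓ (u' t) - D * ℓ (θ' t))
    (w := fun t => ℓ (u t - u' t)) (y := fun t => ℓ (v t - v' t))
    (h := fun t => a * ℓ (u t - u' t) - D * ℓ (θ t - θ' t)) hD
    (fun t => ℓ.hasFDerivAt.comp_hasDerivAt t (h'.hasDerivAt_u t))
    (fun t => (ℓ.hasFDerivAt.comp_hasDerivAt t (h'.hasDerivAt_v t)).congr_deriv
      (by simp only [map_sub, map_smul, smul_eq_mul]; ring))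
    (fun t => (((ℓ.hasFDerivAt.comp_hasDerivAt t (h'.hasDerivAt_u t)).const_mul a).sub
        ((ℓ.hasFDerivAt.comp_hasDerivAt t (h'.hasDerivAt_θ t)).const_mul D)).congr_deriv
      (by simp only [map_sub, map_smul, smul_eq_mul]; ring))
    (fun t => ℓ.hasFDerivAt.comp_hasDerivAt t ((h.hasDerivAt_u t).sub (h'.hasDerivAt_u t)))
    (fun t => (ℓ.hasFDerivAt.comp_hasDerivAt t
        ((h.hasDerivAt_v t).sub (h'.hasDerivAt_v t))).congr_deriv
      (by simp only [map_sub, map_smul, smul_eq_mul]; ring))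
    (fun t => (((ℓ.hasFDerivAt.comp_hasDerivAt t
          ((h.hasDerivAt_u t).sub (h'.hasDerivAt_u t))).const_mul a).sub
        ((ℓ.hasFDerivAt.comp_hasDerivAt t
          ((h.hasDerivAt_θ t).sub (h'.hasDerivAt_θ t))).const_mul D)).congr_deriv
      (by simp only [map_sub, map_smul, smul_eq_mul]; ring))
    (by simp [hu0]) (by simp [hv0]) (by simp [hu0, hθ0]) ht
  set w := ℓ (u t - u' t)
  set y := ℓ (v t - v' t)
  set z := ℓ (θ t - θ' t)
  have h1 : y ^ 2 + K * w ^ 2 + K * z ^ 2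
      ≤ C₁ * (y ^ 2 + c ^ 2 * K * w ^ 2 + κ * K * (a * w - D * z) ^ 2) := by
    have e1 : z ^ 2 ≤ 2 * a ^ 2 / D ^ 2 * w ^ 2 + 2 / D ^ 2 * (a * w - D * z) ^ 2 := by
      have : 2 * a ^ 2 / D ^ 2 * w ^ 2 + 2 / D ^ 2 * (a * w - D * z) ^ 2 - z ^ 2
          = (2 * (a * w) - D * z) ^ 2 / D ^ 2 := by
        field_simp
        ring
      have h2 : 0 ≤ (2 * (a * w) - D * z) ^ 2 / D ^ 2 := by positivity
      linarith
    have e2 : (1 + 2 * a ^ 2 / D ^ 2) * w ^ 2 ≤ C₁ * (c ^ 2 * w ^ 2) := by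
      have : (1 + 2 * a ^ 2 / D ^ 2) / c ^ 2 * (c ^ 2 * w ^ 2) = (1 + 2 * a ^ 2 / D ^ 2) * w ^ 2 := by
        field_simp
      rw [← this]
      refine mul_le_mul_of_nonneg_right ?_ (by positivity)
      have : 0 < 2 / D ^ 2 / κ := by positivity
      linarith
    have e3 : 2 / D ^ 2 * (a * w - D * z) ^ 2 ≤ C₁ * (κ * (a * w - D * z) ^ 2) := by
      have : 2 / D ^ 2 / κ * (κ * (a * w - D * z) ^ 2) = 2 / D ^ 2 * (a * w - D * z) ^ 2 := by
        field_simp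
      rw [← this]
      refine mul_le_mul_of_nonneg_right ?_ (by positivity)
      have : 0 < (1 + 2 * a ^ 2 / D ^ 2) / c ^ 2 := by positivity
      linarith
    have e4 : y ^ 2 ≤ C₁ * y ^ 2 := by
      refine le_mul_of_one_le_left (sq_nonneg _) ?_
      have : 0 < (1 + 2 * a ^ 2 / D ^ 2) / c ^ 2 + 2 / D ^ 2 / κ := by positivity
      linarith
    have e5 : K * (w ^ 2 + z ^ 2) ≤ K * (C₁ * (c ^ 2 * w ^ 2) + C₁ * (κ * (a * w - D * z) ^ 2)) :=
      mul_le_mul_of_nonneg_left (by linarith) hK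
    linarith
  set V := ℓ (v' 0)
  set U := ℓ (u' 0)
  set Θ := ℓ (θ' 0)
  have h2 : V ^ 2 + c ^ 2 * K * U ^ 2 + κ * K * (a * U - D * Θ) ^ 2
      ≤ C₂ * (V ^ 2 + K * U ^ 2 + K * Θ ^ 2) := by
    have e1 : κ * K * (a * U - D * Θ) ^ 2
        ≤ κ * K * (2 * a ^ 2 * U ^ 2 + 2 * D ^ 2 * Θ ^ 2) :=
      mul_le_mul_of_nonneg_left (by linarith [sq_nonneg (a * U + D * Θ)]) (by positivity)
    have e2 : 0 ≤ (c ^ 2 + 2 * κ * a ^ 2 + 2 * κ * D ^ 2) * V ^ 2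
        + (1 + 2 * κ * D ^ 2) * (K * U ^ 2)
        + (1 + c ^ 2 + 2 * κ * a ^ 2) * (K * Θ ^ 2) := by positivity
    linarith
  calc _ ≤ _ := h1
    _ ≤ C₁ * ((1 + β) * ν * (2 * M) * (1 + K) * (C₂ * (V ^ 2 + K * U ^ 2 + K * Θ ^ 2))) := by
      gcongr
      exact key.trans (mul_le_mul_of_nonneg_left h2 (by positivity))
    _ = _ := by ring

/-- The deviation of a viscous mode from the inviscid mode with the same initial data. -/
theorem IsMode.norm_sub_sq_le (m : Medium) :
    ∃ C : ℝ, 0 < C ∧ ∀ ν K : ℝ, 0 ≤ ν → 0 ≤ K → ∀ u v θ u' v' θ' : ℝ → ℂ,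
      IsMode m ν K u v θ → IsMode m 0 K u' v' θ' → u 0 = u' 0 → v 0 = v' 0 → θ 0 = θ' 0 →
      ∀ t, 0 ≤ t →
      ‖v t - v' t‖ ^ 2 + K * ‖u t - u' t‖ ^ 2 + K * ‖θ t - θ' t‖ ^ 2
        ≤ C * ν * (1 + K) * (‖v' 0‖ ^ 2 + K * ‖u' 0‖ ^ 2 + K * ‖θ' 0‖ ^ 2) := by
  obtain ⟨C, hC, H⟩ := IsMode.sub_sq_le_of_functional m
  refine ⟨C, hC, ?_⟩
  intro ν K hν hK u v θ u' v' θ' h h' hu0 hv0 hθ0 t ht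
  have h1 := H Complex.reCLM ν K hν hK u v θ u' v' θ' h h' hu0 hv0 hθ0 t ht
  have h2 := H Complex.imCLM ν K hν hK u v θ u' v' θ' h h' hu0 hv0 hθ0 t ht
  have e : ∀ z : ℂ, ‖z‖ ^ 2 = Complex.reCLM z ^ 2 + Complex.imCLM z ^ 2 := by
    intro z
    rw [← Complex.normSq_eq_norm_sq, Complex.normSq_apply]
    simp [sq]
  simp only [e]
  linarith

/-! ### Linear evolutions and exponentials of multiplication operators. -/

/-- A curve solving a linear equation `X' = M X` with bounded `M` is given by the exponential. -/
theorem eq_exp_smul_apply {H : Type*} [NormedAddCommGroup H] [NormedSpace ℝ H] [CompleteSpace H]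
    (M : H →L[ℝ] H) {X : ℝ → H} (hc : ContinuousOn X (Set.Ici 0))
    (hd : ∀ t, 0 < t → HasDerivAt X (M (X t)) t) {t : ℝ} (ht : 0 ≤ t) :
    X t = NormedSpace.exp (t • M) (X 0) := by
  rcases ht.eq_or_lt with rfl | ht
  · simp
  -- Integrating factor: `U s (X s)` is constant for `s > 0`, and continuity carries the constant to
  -- `s = 0`.
  let U : ℝ → H →L[ℝ] H := fun s => NormedSpace.exp (s • (-M))
  have hU : ∀ s, HasDerivAt U (U s * (-M)) s := fun s => hasDerivAt_exp_smul_const (-M) s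
  have hUc : Continuous U := continuous_iff_continuousAt.2 fun s => (hU s).continuousAt
  let Y : ℝ → H := fun s => U s (X s)
  have hY : ∀ s, 0 < s → HasDerivAt Y 0 s := by
    intro s hs
    have := (hU s).clm_apply (hd s hs)
    simpa [Y] using this
  have hconst : ∀ s, 0 < s → Y s = Y t := by
    intro s hs
    have := (convex_Ioi (0 : ℝ)).norm_image_sub_le_of_norm_hasDerivWithin_le (f := Y) (f' := 0)
      (C := 0) (fun x hx => (hY x hx).hasDerivWithinAt) (fun x _ => by simp) ht hs
    simpa [sub_eq_zero] using this
  have hY0 : Tendsto Y (𝓝[>] 0) (𝓝 (Y 0)) := by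
    have hX : ContinuousWithinAt X (Set.Ioi 0) 0 :=
      (hc 0 Set.self_mem_Ici).mono Set.Ioi_subset_Ici_self
    exact hUc.continuousAt.continuousWithinAt.clm_apply hX
  have hY0' : Y 0 = Y t := by
    refine tendsto_nhds_unique hY0 (tendsto_const_nhds.congr' ?_)
    filter_upwards [self_mem_nhdsWithin] with s hs using (hconst s hs).symm
  have hinv : NormedSpace.exp (t • M) * U t = 1 := by
    let : NormedAlgebra ℚ (H →L[ℝ] H) := NormedAlgebra.restrictScalars ℚ ℝ _
    simp only [U]
    rw [smul_neg, ← NormedSpace.exp_add_of_commute (Commute.neg_right (Commute.refl _))]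
    simp
  calc X t = (NormedSpace.exp (t • M) * U t) (X t) := by rw [hinv]; rfl
    _ = NormedSpace.exp (t • M) (Y t) := rfl
    _ = NormedSpace.exp (t • M) (X 0) := by rw [← hY0']; simp [Y, U]

theorem tendsto_sum_exp_smul_apply {F : Type*} [NormedAddCommGroup F] [NormedSpace ℝ F]
    [CompleteSpace F] (B : F →L[ℝ] F) (t : ℝ) (x : F) :
    Tendsto (fun N => ∑ k ∈ Finset.range N, ((k.factorial : ℝ)⁻¹ * t ^ k) • (B ^ k) x) atTop
      (𝓝 (NormedSpace.exp (t • B) x)) := by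
  have h1 := NormedSpace.exp_series_hasSum_exp' (𝕂 := ℝ) (t • B)
  have h2 := (ContinuousLinearMap.apply ℝ F x).hasSum h1
  simpa [smul_pow, smul_smul] using h2.tendsto_sum_nat

/-- The exponential of a bounded multiplication operator acts pointwise. -/
theorem exp_smul_apply_ae {Ω E : Type*} [MeasurableSpace Ω] {μ : Measure Ω}
    [NormedAddCommGroup E] [NormedSpace ℝ E] [CompleteSpace E] {p : ℝ≥0∞} [Fact (1 ≤ p)]
    (M : Lp E p μ →L[ℝ] Lp E p μ) (A : Ω → E →L[ℝ] E)
    (hM : ∀ f : Lp E p μ, M f =ᵐ[μ] fun x => A x (f x)) (t : ℝ) (f : Lp E p μ) :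
    NormedSpace.exp (t • M) f =ᵐ[μ] fun x => NormedSpace.exp (t • A x) (f x) := by
  have hpow : ∀ k : ℕ, ∀ᵐ x ∂μ, ((M ^ k) f : Lp E p μ) x = (A x ^ k) (f x) := by
    intro k
    induction k with
    | zero => simp
    | succ k ih =>
      filter_upwards [ih, hM ((M ^ k) f)] with x h1 h2
      rw [pow_succ', pow_succ', mul_apply_eq_comp, h2, h1,
        mul_apply_eq_comp]
  let a : ℕ → ℝ := fun k => (k.factorial : ℝ)⁻¹ * t ^ k
  have hpart : ∀ N : ℕ, ∀ᵐ x ∂μ, (∑ k ∈ Finset.range N, a k • (M ^ k) f : Lp E p μ) x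
      = ∑ k ∈ Finset.range N, a k • (A x ^ k) (f x) := by
    intro N
    induction N with
    | zero =>
      filter_upwards [Lp.coeFn_zero E p μ] with x hx
      simpa using hx
    | succ N ih =>
      rw [Finset.sum_range_succ]
      filter_upwards [ih, Lp.coeFn_add (∑ k ∈ Finset.range N, a k • (M ^ k) f) (a N • (M ^ N) f),
        Lp.coeFn_smul (a N) ((M ^ N) f), hpow N] with x h1 h2 h3 h4
      rw [h2, Pi.add_apply, h1, h3, Pi.smul_apply, h4, Finset.sum_range_succ]
  -- Convergence of the series in `Lp` gives almost everywhere convergence only along a subsequence;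
  -- this suffices because the pointwise exponential series converges in full.
  obtain ⟨ns, hns, hlim⟩ :=
    (tendstoInMeasure_of_tendsto_Lp (tendsto_sum_exp_smul_apply M t f)).exists_seq_tendsto_ae
  filter_upwards [hlim, ae_all_iff.2 hpart] with x h1 h2
  refine tendsto_nhds_unique h1 ?_
  exact ((tendsto_sum_exp_smul_apply (A x) t (f x)).comp hns.tendsto_atTop).congr
    fun i => (h2 (ns i)).symm

/-! ### The equations on the Fourier side. -/

/-- Evaluation of square-integrable functions, seen as distributions, at a Schwartz function. -/
noncomputable def evalL2 (η : 𝓢(Space n, ℂ)) : L2 n →L[ℝ] ℂ :=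
  ((PointwiseConvergenceCLM.evalCLM _ ℂ η).comp
    (Lp.toTemperedDistributionCLM ℂ (volume : Measure (Space n)) 2)).restrictScalars ℝ

theorem evalL2_apply (η : 𝓢(Space n, ℂ)) (f : L2 n) :
    evalL2 η f = (f : 𝓢'(Space n, ℂ)) η := rfl

theorem toTemperedDistribution_injective {p : ℝ≥0∞} [Fact (1 ≤ p)] {f g : Lp ℂ p (volume : Measure (Space n))}
    (h : (f : 𝓢'(Space n, ℂ)) = g) : f = g :=
  LinearMap.ker_eq_bot.1 (Lp.ker_toTemperedDistributionCLM_eq_bot (F := ℂ)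
    (μ := (volume : Measure (Space n))) (p := p)) h

/-- A curve in `L²` whose derivative tested with Schwartz functions is a continuous curve in `L²` is
differentiable in `L²`. -/
theorem hasDerivAt_of_tested {w R : ℝ → L2 n} (hR : ContinuousOn R (Set.Ioi 0))
    (h : ∀ t, 0 < t → ∀ η : 𝓢(Space n, ℂ),
      HasDerivAt (fun τ => (w τ : 𝓢'(Space n, ℂ)) η) ((R t : 𝓢'(Space n, ℂ)) η) t)
    {t : ℝ} (ht : 0 < t) : HasDerivAt w (R t) t := by
  have hsub : ∀ τ, 0 < τ → Set.uIcc t τ ⊆ Set.Ioi 0 := by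
    intro τ hτ s hs
    exact (lt_min ht hτ).trans_le hs.1
  have hint : ∀ τ, 0 < τ → IntervalIntegrable R volume t τ := fun τ hτ =>
    (hR.mono (hsub τ hτ)).intervalIntegrable
  -- The fundamental theorem of calculus holds after testing, and an `L²` function is determined by
  -- its values on Schwartz functions.
  have hEq : ∀ τ, 0 < τ → w τ = w t + ∫ s in t..τ, R s := by
    intro τ hτ
    apply toTemperedDistribution_injective
    ext η
    change evalL2 η _ = evalL2 η _
    rw [map_add, ← ContinuousLinearMap.intervalIntegral_comp_comm _ (hint τ hτ)]
    have := intervalIntegral.integral_eq_sub_of_hasDerivAt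
      (f := fun τ => evalL2 η (w τ)) (f' := fun s => evalL2 η (R s)) (a := t) (b := τ)
      (fun s hs => h s (hsub τ hτ hs) η)
      (((evalL2 η).continuous.comp_continuousOn (hR.mono (hsub τ hτ))).intervalIntegrable)
    rw [this]
    ring
  have hderiv : HasDerivAt (fun τ => w t + ∫ s in t..τ, R s) (R t) t := by
    refine HasDerivAt.const_add _ ?_
    refine intervalIntegral.integral_hasDerivAt_right (hint t ht) ?_
      (hR.continuousAt (Ioi_mem_nhds ht))
    exact hR.stronglyMeasurableAtFilter isOpen_Ioi t ht
  refine hderiv.congr_of_eventuallyEq ?_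
  filter_upwards [Ioi_mem_nhds ht] with τ hτ using hEq τ hτ

/-- Multiplication by a bounded function on `L²`. -/
noncomputable def mulL2 {g : Space n → ℂ} (hg : MemLp g ∞ volume) : L2 n →L[ℝ] L2 n :=
  ((ContinuousLinearMap.lsmul ℂ ℂ : ℂ →L[ℂ] ℂ →L[ℂ] ℂ).holderL volume ∞ 2 2 (hg.toLp g)).restrictScalars ℝ

theorem coeFn_mulL2 {g : Space n → ℂ} (hg : MemLp g ∞ volume) (f : L2 n) :
    mulL2 hg f =ᵐ[volume] fun ξ => g ξ * f ξ := by
  have h := (ContinuousLinearMap.lsmul ℂ ℂ : ℂ →L[ℂ] ℂ →L[ℂ] ℂ).coeFn_holder (r := 2)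
    (hg.toLp g) f
  filter_upwards [h, hg.coeFn_toLp] with ξ h1 h2
  change ((ContinuousLinearMap.lsmul ℂ ℂ : ℂ →L[ℂ] ℂ →L[ℂ] ℂ).holder 2 (hg.toLp g) f : L2 n) ξ = _
  rw [h1, h2]
  rfl

theorem mulL2_toTemperedDistribution {g : Space n → ℂ} (hg : MemLp g ∞ volume)
    (hg' : g.HasTemperateGrowth) (f : L2 n) (η : 𝓢(Space n, ℂ)) :
    (mulL2 hg f : 𝓢'(Space n, ℂ)) η
      = (f : 𝓢'(Space n, ℂ)) (SchwartzMap.smulLeftCLM ℂ g η) := by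
  simp only [Lp.toTemperedDistribution_apply]
  apply integral_congr_ae
  filter_upwards [coeFn_mulL2 hg f] with ξ h
  rw [h, SchwartzMap.smulLeftCLM_apply_apply hg']
  simp only [smul_eq_mul]
  ring

/-- The symbol of `-Δ`. -/
noncomputable def freqSq (ξ : Space n) : ℝ := ‖(2 * Real.pi) • ξ‖ ^ 2

theorem freqSq_nonneg (ξ : Space n) : 0 ≤ freqSq ξ := sq_nonneg _

theorem freqSq_eq (ξ : Space n) : freqSq ξ = (2 * Real.pi) ^ 2 * ‖ξ‖ ^ 2 := by
  rw [freqSq, norm_smul, mul_pow, Real.norm_eq_abs, sq_abs]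

theorem continuous_freqSq : Continuous (freqSq : Space n → ℝ) := by
  unfold freqSq
  fun_prop

theorem freqSq_hasTemperateGrowth :
    (fun ξ : Space n => ((freqSq ξ : ℝ) : ℂ)).HasTemperateGrowth := by
  have h : (fun ξ : Space n => (((2 * Real.pi) ^ 2 * ‖ξ‖ ^ 2 : ℝ) : ℂ)).HasTemperateGrowth := by
    fun_prop
  simpa only [freqSq_eq] using h

theorem fourier_laplacian (u : 𝓢'(Space n, ℂ)) :
    𝓕 (Δ u) = -TemperedDistribution.smulLeftCLM ℂ (fun ξ : Space n => ((freqSq ξ : ℝ) : ℂ)) (𝓕 u) := by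
  have hg : (fun ξ : Space n => ((‖ξ‖ ^ 2 : ℝ) : ℂ)).HasTemperateGrowth := by fun_prop
  have h1 : (fun ξ : Space n => ((freqSq ξ : ℝ) : ℂ))
      = (((2 * Real.pi) ^ 2 : ℝ) : ℂ) • fun ξ : Space n => ((‖ξ‖ ^ 2 : ℝ) : ℂ) := by
    funext ξ
    simp [freqSq_eq]
  rw [h1, TemperedDistribution.smulLeftCLM_smul hg,
    TemperedDistribution.laplacian_eq_fourierMultiplierCLM]
  rw [← Complex.coe_smul (-(2 * Real.pi) ^ 2), FourierTransform.fourier_smul,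
    TemperedDistribution.fourierMultiplierCLM_apply, FourierTransform.fourier_fourierInv_eq,
    Complex.ofReal_neg]
  ext η
  simp

theorem laplacian_apply_fourier (u : 𝓢'(Space n, ℂ)) (η : 𝓢(Space n, ℂ)) :
    (Δ u) (𝓕 η) = -(𝓕 u) (SchwartzMap.smulLeftCLM ℂ (fun ξ : Space n => ((freqSq ξ : ℝ) : ℂ)) η) := by
  rw [← TemperedDistribution.fourier_apply, fourier_laplacian]
  rfl

/-- The regularizing multiplier `⟨ξ⟩⁻²`. -/
noncomputable def regSymbol (ξ : Space n) : ℂ := japaneseSymbol n (-2) ξ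

theorem regSymbol_eq (ξ : Space n) : regSymbol ξ = (((1 + freqSq ξ)⁻¹ : ℝ) : ℂ) := by
  rw [regSymbol, japaneseSymbol, freqSq]
  norm_num [Real.rpow_neg_one]

theorem regSymbol_hasTemperateGrowth : (regSymbol : Space n → ℂ).HasTemperateGrowth :=
  japaneseSymbol_hasTemperateGrowth n (-2)

theorem memLp_regSymbol : MemLp (regSymbol : Space n → ℂ) ∞ volume := by
  refine memLp_top_of_bound ?_ 1 (Eventually.of_forall fun ξ => ?_)
  · exact regSymbol_hasTemperateGrowth.1.continuous.aestronglyMeasurable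
  · have := freqSq_nonneg ξ
    rw [regSymbol_eq, Complex.norm_real, Real.norm_of_nonneg (by positivity)]
    exact inv_le_one_of_one_le₀ (by linarith)

/-- The multiplier `|k|² ⟨ξ⟩⁻²`. -/
noncomputable def regLaplaceSymbol : Space n → ℂ :=
  regSymbol * fun ξ => ((freqSq ξ : ℝ) : ℂ)

theorem regLaplaceSymbol_hasTemperateGrowth :
    (regLaplaceSymbol : Space n → ℂ).HasTemperateGrowth :=
  regSymbol_hasTemperateGrowth.mul freqSq_hasTemperateGrowth

theorem memLp_regLaplaceSymbol : MemLp (regLaplaceSymbol : Space n → ℂ) ∞ volume := by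
  refine memLp_top_of_bound ?_ 1 (Eventually.of_forall fun ξ => ?_)
  · exact regLaplaceSymbol_hasTemperateGrowth.1.continuous.aestronglyMeasurable
  · have := freqSq_nonneg ξ
    rw [regLaplaceSymbol, Pi.mul_apply, regSymbol_eq, ← Complex.ofReal_mul, Complex.norm_real,
      Real.norm_of_nonneg (by positivity), ← div_eq_inv_mul, div_le_one (by positivity)]
    linarith

/-- The Fourier transform on `L²` as a real-linear continuous map. -/
noncomputable def fourierL2 : L2 n →L[ℝ] L2 n :=
  (FourierTransform.fourierCLM ℂ (L2 n)).restrictScalars ℝ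

/-- The test functions `𝓕 (⟨ξ⟩⁻² η)` turn `-Δ` into multiplication by `K/(1+K)`, a bounded operator
on `L²`. The right sides of the regularized equations are then continuous `L²` curves, as
`hasDerivAt_of_tested` requires. -/
theorem laplacian_apply_fourier_regSymbol (u : L2 n) (η : 𝓢(Space n, ℂ)) :
    (Δ (u : 𝓢'(Space n, ℂ))) (𝓕 (SchwartzMap.smulLeftCLM ℂ regSymbol η))
      = -((mulL2 memLp_regLaplaceSymbol (fourierL2 u) : L2 n) : 𝓢'(Space n, ℂ)) η := by
  rw [laplacian_apply_fourier, mulL2_toTemperedDistribution _ regLaplaceSymbol_hasTemperateGrowth,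
    show ((fourierL2 u : L2 n) : 𝓢'(Space n, ℂ)) = 𝓕 (u : 𝓢'(Space n, ℂ)) from
      (Lp.fourier_toTemperedDistribution_eq u).symm,
    SchwartzMap.smulLeftCLM_smulLeftCLM_apply freqSq_hasTemperateGrowth
      regSymbol_hasTemperateGrowth]
  rw [regLaplaceSymbol, mul_comm]

theorem mulL2_regSymbol_fourier_apply (u : L2 n) (η : 𝓢(Space n, ℂ)) :
    ((mulL2 memLp_regSymbol (fourierL2 u) : L2 n) : 𝓢'(Space n, ℂ)) η
      = (u : 𝓢'(Space n, ℂ)) (𝓕 (SchwartzMap.smulLeftCLM ℂ regSymbol η)) := by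
  rw [mulL2_toTemperedDistribution _ regSymbol_hasTemperateGrowth]
  change ((𝓕 u : L2 n) : 𝓢'(Space n, ℂ)) _ = _
  rw [← Lp.fourier_toTemperedDistribution_eq]
  rfl

theorem apply_eq_zero_of_eq_zero₃ {A B C : 𝓢'(Space n, ℂ)} {r s : ℝ} (h : A - r • B + s • C = 0)
    (ψ : 𝓢(Space n, ℂ)) : A ψ - r * B ψ + s * C ψ = 0 := by
  simpa using DFunLike.congr_fun h ψ

theorem apply_eq_zero_of_eq_zero₄ {A B C D : 𝓢'(Space n, ℂ)} {r s q : ℝ}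
    (h : A - r • B - q • D + s • C = 0) (ψ : 𝓢(Space n, ℂ)) :
    A ψ - r * B ψ - q * D ψ + s * C ψ = 0 := by
  simpa using DFunLike.congr_fun h ψ

section Solution

variable {m : Medium} {ν : ℝ} {φ₀ φ₁ T₀ : 𝓢'(Space n, ℂ)} {φ φt T : ℝ → L2 n}

theorem continuousOn_smul_sub_smul {H : Type*} [NormedAddCommGroup H] [NormedSpace ℝ H] {S : Set ℝ}
    {f g : ℝ → H} (hf : ContinuousOn f S) (hg : ContinuousOn g S) (r q : ℝ) :
    ContinuousOn (fun t => r • f t - q • g t) S :=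
  (hf.const_smul r).sub (hg.const_smul q)

theorem continuousOn_mulL2_fourierL2 {f : ℝ → L2 n} (hf : ContinuousOn f (Set.Ici 0)) :
    ContinuousOn (fun t => mulL2 memLp_regLaplaceSymbol (fourierL2 (f t))) (Set.Ioi 0) :=
  (mulL2 memLp_regLaplaceSymbol).continuous.comp_continuousOn
    (fourierL2.continuous.comp_continuousOn (hf.mono Set.Ioi_subset_Ici_self))

theorem IsSolution.hasDerivAt_fourier_θ (h : IsSolution m ν φ₀ φ₁ T₀ φ φt T) {t : ℝ}
    (ht : 0 < t) :
    HasDerivAt (fun τ => mulL2 memLp_regSymbol (fourierL2 (T τ)))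
      (((m.γ - 1) / m.αp) • mulL2 memLp_regLaplaceSymbol (fourierL2 (φ t))
        - (m.γ * m.Dth) • mulL2 memLp_regLaplaceSymbol (fourierL2 (T t))) t := by
  refine hasDerivAt_of_tested (R := fun t =>
    (((m.γ - 1) / m.αp) • mulL2 memLp_regLaplaceSymbol (fourierL2 (φ t))
        - (m.γ * m.Dth) • mulL2 memLp_regLaplaceSymbol (fourierL2 (T t)))) ?_ ?_ ht
  · exact continuousOn_smul_sub_smul (continuousOn_mulL2_fourierL2 h.continuousOn_φ)
      (continuousOn_mulL2_fourierL2 h.continuousOn_T) _ _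
  · intro t ht η
    obtain ⟨φtt, Tt, -, hTt, -, e⟩ := h.equations t ht
    simp only [mulL2_regSymbol_fourier_apply]
    refine (hTt (𝓕 (SchwartzMap.smulLeftCLM ℂ regSymbol η))).congr_deriv ?_
    have e' := apply_eq_zero_of_eq_zero₃ e (𝓕 (SchwartzMap.smulLeftCLM ℂ regSymbol η))
    rw [laplacian_apply_fourier_regSymbol, laplacian_apply_fourier_regSymbol] at e'
    rw [← evalL2_apply, map_sub, map_smul, map_smul, evalL2_apply, evalL2_apply,
      Complex.real_smul, Complex.real_smul]
    linear_combination e'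

theorem IsSolution.hasDerivAt_fourier_v (h : IsSolution m ν φ₀ φ₁ T₀ φ φt T) {t : ℝ}
    (ht : 0 < t) :
    HasDerivAt (fun τ => mulL2 memLp_regSymbol (fourierL2 (φt τ)))
      (-(m.c₀ ^ 2) • mulL2 memLp_regLaplaceSymbol (fourierL2 (φ t))
        - ((1 + m.β) * ν) • mulL2 memLp_regLaplaceSymbol (fourierL2 (φt t))
        - (m.αp * m.c₀ ^ 2) •
          (((m.γ - 1) / m.αp) • mulL2 memLp_regLaplaceSymbol (fourierL2 (φ t))
          - (m.γ * m.Dth) • mulL2 memLp_regLaplaceSymbol (fourierL2 (T t)))) t := by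
  refine hasDerivAt_of_tested (R := fun t =>
    (-(m.c₀ ^ 2) • mulL2 memLp_regLaplaceSymbol (fourierL2 (φ t))
        - ((1 + m.β) * ν) • mulL2 memLp_regLaplaceSymbol (fourierL2 (φt t))
        - (m.αp * m.c₀ ^ 2) •
          (((m.γ - 1) / m.αp) • mulL2 memLp_regLaplaceSymbol (fourierL2 (φ t))
          - (m.γ * m.Dth) • mulL2 memLp_regLaplaceSymbol (fourierL2 (T t))))) ?_ ?_ ht
  · have hφ := continuousOn_mulL2_fourierL2 h.continuousOn_φ
    have hφt := continuousOn_mulL2_fourierL2 h.continuousOn_φt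
    have hT := continuousOn_mulL2_fourierL2 h.continuousOn_T
    have h₁ := continuousOn_smul_sub_smul hφ hφt (-(m.c₀ ^ 2)) ((1 + m.β) * ν)
    have h₂ := continuousOn_smul_sub_smul hφ hT ((m.γ - 1) / m.αp) (m.γ * m.Dth)
    simpa only [one_smul] using continuousOn_smul_sub_smul h₁ h₂ 1 (m.αp * m.c₀ ^ 2)
  · intro t ht η
    obtain ⟨φtt, Tt, hφtt, hTt, e₁, e⟩ := h.equations t ht
    simp only [mulL2_regSymbol_fourier_apply]
    refine (hφtt (𝓕 (SchwartzMap.smulLeftCLM ℂ regSymbol η))).congr_deriv ?_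
    have e' := apply_eq_zero_of_eq_zero₃ e (𝓕 (SchwartzMap.smulLeftCLM ℂ regSymbol η))
    have e₁' := apply_eq_zero_of_eq_zero₄ e₁ (𝓕 (SchwartzMap.smulLeftCLM ℂ regSymbol η))
    rw [laplacian_apply_fourier_regSymbol, laplacian_apply_fourier_regSymbol] at e' e₁'
    rw [← evalL2_apply]
    simp only [map_sub, map_smul, evalL2_apply, Complex.real_smul, Complex.ofReal_neg]
    -- Subtracting this multiple of the heat equation eliminates `T_t` from the wave equation.
    linear_combination e₁' - ((m.αp * m.c₀ ^ 2 : ℝ) : ℂ) * e'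

end Solution

/-! ### From solutions to modes by truncation to low frequencies. -/

/-- The matrix of the mode equations, as a function of the symbol `K` of `-Δ`. -/
noncomputable def modeGenerator (m : Medium) (ν K : ℝ) : (ℂ × ℂ × ℂ) →L[ℝ] (ℂ × ℂ × ℂ) :=
  let u := ContinuousLinearMap.fst ℝ ℂ (ℂ × ℂ)
  let v := (ContinuousLinearMap.fst ℝ ℂ ℂ).comp (ContinuousLinearMap.snd ℝ ℂ (ℂ × ℂ))
  let θ := (ContinuousLinearMap.snd ℝ ℂ ℂ).comp (ContinuousLinearMap.snd ℝ ℂ (ℂ × ℂ))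
  v.prod 0 + K • (0 : (ℂ × ℂ × ℂ) →L[ℝ] ℂ).prod
    ((-(m.c₀ ^ 2) • u - ((1 + m.β) * ν) • v
        - (m.αp * m.c₀ ^ 2) • (((m.γ - 1) / m.αp) • u - (m.γ * m.Dth) • θ)).prod
      (((m.γ - 1) / m.αp) • u - (m.γ * m.Dth) • θ))

theorem modeGenerator_apply (m : Medium) (ν K : ℝ) (x : ℂ × ℂ × ℂ) :
    modeGenerator m ν K x = (x.2.1, K • (-(m.c₀ ^ 2) • x.1 - ((1 + m.β) * ν) • x.2.1
        - (m.αp * m.c₀ ^ 2) • (((m.γ - 1) / m.αp) • x.1 - (m.γ * m.Dth) • x.2.2)),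
      K • (((m.γ - 1) / m.αp) • x.1 - (m.γ * m.Dth) • x.2.2)) := by
  simp [modeGenerator]

theorem continuous_modeGenerator (m : Medium) (ν : ℝ) : Continuous (modeGenerator m ν) := by
  unfold modeGenerator
  fun_prop

theorem exp_zero_smul_apply {F : Type*} [NormedAddCommGroup F] [NormedSpace ℝ F]
    (B : F →L[ℝ] F) (x : F) : NormedSpace.exp ((0 : ℝ) • B) x = x := by
  simp

theorem isMode_exp (m : Medium) (ν K : ℝ) (x : ℂ × ℂ × ℂ) :
    IsMode m ν K (fun s => (NormedSpace.exp (s • modeGenerator m ν K) x).1)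
      (fun s => (NormedSpace.exp (s • modeGenerator m ν K) x).2.1)
      (fun s => (NormedSpace.exp (s • modeGenerator m ν K) x).2.2) := by
  have h : ∀ t, HasDerivAt (fun s : ℝ => NormedSpace.exp (s • modeGenerator m ν K) x)
      (modeGenerator m ν K (NormedSpace.exp (t • modeGenerator m ν K) x)) t := by
    intro t
    have := (hasDerivAt_exp_smul_const' (𝕂 := ℝ) (modeGenerator m ν K) t).clm_apply
      (hasDerivAt_const t x)
    simpa using this
  simp only [modeGenerator_apply] at h
  refine ⟨fun t => (h t).fst, fun t => ?_, fun t => ?_⟩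
  · refine (((ContinuousLinearMap.fst ℝ ℂ ℂ).comp
      (ContinuousLinearMap.snd ℝ ℂ (ℂ × ℂ))).hasFDerivAt.comp_hasDerivAt t (h t)).congr_deriv ?_
    simp only [ContinuousLinearMap.comp_apply, ContinuousLinearMap.coe_fst',
      ContinuousLinearMap.coe_snd']
    simp only [Complex.real_smul]
    push_cast
    ring
  · refine (((ContinuousLinearMap.snd ℝ ℂ ℂ).comp
      (ContinuousLinearMap.snd ℝ ℂ (ℂ × ℂ))).hasFDerivAt.comp_hasDerivAt t (h t)).congr_deriv ?_
    simp only [ContinuousLinearMap.comp_apply, ContinuousLinearMap.coe_snd']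
    simp only [Complex.real_smul]
    push_cast
    ring

/-- The symbol of `-Δ` cut off at level `R`. -/
noncomputable def cutFreqSq (R : ℝ) (ξ : Space n) : ℝ := if freqSq ξ ≤ R then freqSq ξ else 0

theorem measurable_cutFreqSq (R : ℝ) : Measurable (cutFreqSq R : Space n → ℝ) :=
  Measurable.ite (continuous_freqSq.measurable measurableSet_Iic) continuous_freqSq.measurable
    measurable_const

theorem cutFreqSq_mem_Icc {R : ℝ} (hR : 0 ≤ R) (ξ : Space n) : cutFreqSq R ξ ∈ Set.Icc 0 R := by
  unfold cutFreqSq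
  split_ifs with h
  · exact ⟨freqSq_nonneg ξ, h⟩
  · exact ⟨le_rfl, hR⟩

theorem memLp_modeGenerator_cutFreqSq (m : Medium) (ν : ℝ) {R : ℝ} (hR : 0 ≤ R) :
    MemLp (fun ξ : Space n => modeGenerator m ν (cutFreqSq R ξ)) ∞ volume := by
  obtain ⟨B, hB⟩ := (isCompact_Icc (a := (0 : ℝ)) (b := R)).exists_bound_of_continuousOn
    (continuous_modeGenerator m ν).continuousOn
  refine memLp_top_of_bound ?_ B (Eventually.of_forall fun ξ => hB _ (cutFreqSq_mem_Icc hR ξ))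
  exact ((continuous_modeGenerator m ν).comp_stronglyMeasurable
    (measurable_cutFreqSq R).stronglyMeasurable).aestronglyMeasurable

/-- The multiplier undoing `⟨ξ⟩⁻²` on the low frequencies and vanishing on the high ones. -/
noncomputable def cutSymbol (R : ℝ) (ξ : Space n) : ℂ :=
  if freqSq ξ ≤ R then ((1 + freqSq ξ : ℝ) : ℂ) else 0

theorem memLp_cutSymbol {R : ℝ} (hR : 0 ≤ R) : MemLp (cutSymbol R : Space n → ℂ) ∞ volume := by
  refine memLp_top_of_bound ?_ (1 + R) (Eventually.of_forall fun ξ => ?_)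
  · refine (Measurable.ite (continuous_freqSq.measurable measurableSet_Iic) ?_
      measurable_const).aestronglyMeasurable
    exact Complex.measurable_ofReal.comp (continuous_freqSq.measurable.const_add 1)
  · have := freqSq_nonneg ξ
    unfold cutSymbol
    split_ifs with h
    · rw [Complex.norm_real, Real.norm_of_nonneg (by positivity)]
      linarith
    · simpa using by positivity

theorem cutSymbol_mul_regSymbol (R : ℝ) (ξ : Space n) :
    cutSymbol R ξ * regSymbol ξ = if freqSq ξ ≤ R then 1 else 0 := by
  have := freqSq_nonneg ξ
  unfold cutSymbol
  split_ifs with h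
  · rw [regSymbol_eq, ← Complex.ofReal_mul, mul_inv_cancel₀ (by positivity), Complex.ofReal_one]
  · simp

theorem coeFn_cut_reg {R : ℝ} (hR : 0 ≤ R) (f : L2 n) :
    mulL2 (memLp_cutSymbol hR) (mulL2 memLp_regSymbol f)
      =ᵐ[volume] fun ξ => if freqSq ξ ≤ R then f ξ else 0 := by
  filter_upwards [coeFn_mulL2 (memLp_cutSymbol hR) (mulL2 memLp_regSymbol f),
    coeFn_mulL2 memLp_regSymbol f] with ξ h1 h2
  rw [h1, h2, ← mul_assoc, cutSymbol_mul_regSymbol]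
  split_ifs <;> simp

theorem coeFn_cut_regLaplace {R : ℝ} (hR : 0 ≤ R) (f : L2 n) :
    mulL2 (memLp_cutSymbol hR) (mulL2 memLp_regLaplaceSymbol f)
      =ᵐ[volume] fun ξ => cutFreqSq R ξ • if freqSq ξ ≤ R then f ξ else 0 := by
  filter_upwards [coeFn_mulL2 (memLp_cutSymbol hR) (mulL2 memLp_regLaplaceSymbol f),
    coeFn_mulL2 memLp_regLaplaceSymbol f] with ξ h1 h2
  rw [h1, h2, regLaplaceSymbol, Pi.mul_apply, ← mul_assoc, ← mul_assoc, cutSymbol_mul_regSymbol,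
    cutFreqSq]
  split_ifs <;> simp

/-- Three square-integrable functions assembled into a vector-valued one. -/
noncomputable def tripleL2 :
    (L2 n × L2 n × L2 n) →L[ℝ] Lp (ℂ × ℂ × ℂ) 2 (volume : Measure (Space n)) :=
  ((ContinuousLinearMap.inl ℝ ℂ (ℂ × ℂ)).compLpL 2 volume).coprod
    ((((ContinuousLinearMap.inr ℝ ℂ (ℂ × ℂ)).comp (ContinuousLinearMap.inl ℝ ℂ ℂ)).compLpL 2
      volume).coprod
    (((ContinuousLinearMap.inr ℝ ℂ (ℂ × ℂ)).comp (ContinuousLinearMap.inr ℝ ℂ ℂ)).compLpL 2 volume))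

theorem coeFn_tripleL2 (f g h : L2 n) :
    tripleL2 (f, g, h) =ᵐ[volume] fun ξ => (f ξ, g ξ, h ξ) := by
  set a := (ContinuousLinearMap.inl ℝ ℂ (ℂ × ℂ)).compLpL 2 volume f
  set b := ((ContinuousLinearMap.inr ℝ ℂ (ℂ × ℂ)).comp
    (ContinuousLinearMap.inl ℝ ℂ ℂ)).compLpL 2 volume g
  set c := ((ContinuousLinearMap.inr ℝ ℂ (ℂ × ℂ)).comp
    (ContinuousLinearMap.inr ℝ ℂ ℂ)).compLpL 2 volume h
  change (a + (b + c) : Lp (ℂ × ℂ × ℂ) 2 (volume : Measure (Space n))) =ᵐ[volume] _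
  filter_upwards [Lp.coeFn_add a (b + c), Lp.coeFn_add b c,
    ContinuousLinearMap.coeFn_compLpL (p := 2) (μ := volume)
      (ContinuousLinearMap.inl ℝ ℂ (ℂ × ℂ)) f,
    ContinuousLinearMap.coeFn_compLpL (p := 2) (μ := volume)
      ((ContinuousLinearMap.inr ℝ ℂ (ℂ × ℂ)).comp (ContinuousLinearMap.inl ℝ ℂ ℂ)) g,
    ContinuousLinearMap.coeFn_compLpL (p := 2) (μ := volume)
      ((ContinuousLinearMap.inr ℝ ℂ (ℂ × ℂ)).comp (ContinuousLinearMap.inr ℝ ℂ ℂ)) h]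
    with ξ h1 h2 h3 h4 h5
  rw [h1, Pi.add_apply, h2, Pi.add_apply, h3, h4, h5]
  simp

theorem coeFn_smul_sub_smul (f g : L2 n) (r q : ℝ) :
    (r • f - q • g : L2 n) =ᵐ[volume] fun ξ => r • f ξ - q • g ξ := by
  filter_upwards [Lp.coeFn_sub (r • f) (q • g), Lp.coeFn_smul r f, Lp.coeFn_smul q g]
    with ξ h1 h2 h3
  rw [h1, Pi.sub_apply, h2, h3]
  rfl

/-- On `K ≤ R` the regularization can be undone by a bounded multiplier, and the generator is
bounded there. The truncated triple solves a linear ODE in `L²` with a bounded multiplication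
operator, whose exponential acts frequency by frequency. -/
theorem IsSolution.exists_isMode_of_le {m : Medium} {ν : ℝ} {φ₀ φ₁ T₀ : 𝓢'(Space n, ℂ)}
    {φ φt T : ℝ → L2 n} (h : IsSolution m ν φ₀ φ₁ T₀ φ φt T) {R : ℝ} (hR : 0 ≤ R) {t : ℝ}
    (ht : 0 ≤ t) :
    ∀ᵐ ξ : Space n, freqSq ξ ≤ R → ∃ u v θ : ℝ → ℂ, IsMode m ν (freqSq ξ) u v θ ∧
      u 0 = fourierL2 (φ 0) ξ ∧ v 0 = fourierL2 (φt 0) ξ ∧ θ 0 = fourierL2 (T 0) ξ ∧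
      u t = fourierL2 (φ t) ξ ∧ v t = fourierL2 (φt t) ξ ∧ θ t = fourierL2 (T t) ξ := by
  let cut := mulL2 (memLp_cutSymbol (n := n) hR)
  let reg := mulL2 (memLp_regSymbol (n := n))
  let M : Lp (ℂ × ℂ × ℂ) 2 (volume : Measure (Space n)) →L[ℝ]
      Lp (ℂ × ℂ × ℂ) 2 (volume : Measure (Space n)) :=
    (ContinuousLinearMap.id ℝ ((ℂ × ℂ × ℂ) →L[ℝ] (ℂ × ℂ × ℂ))).holderL volume ∞ 2 2
      (memLp_modeGenerator_cutFreqSq m ν hR).toLp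
  have hM : ∀ f, M f =ᵐ[volume] fun ξ => modeGenerator m ν (cutFreqSq R ξ) (f ξ) := by
    intro f
    have e := (ContinuousLinearMap.id ℝ ((ℂ × ℂ × ℂ) →L[ℝ] (ℂ × ℂ × ℂ))).coeFn_holder (r := 2)
      (memLp_modeGenerator_cutFreqSq (n := n) m ν hR).toLp f
    filter_upwards [e, (memLp_modeGenerator_cutFreqSq (n := n) m ν hR).coeFn_toLp] with ξ h1 h2
    change ((ContinuousLinearMap.id ℝ ((ℂ × ℂ × ℂ) →L[ℝ] (ℂ × ℂ × ℂ))).holder 2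
      (memLp_modeGenerator_cutFreqSq (n := n) m ν hR).toLp f : Lp _ 2 _) ξ = _
    rw [h1, h2]
    rfl
  let low : L2 n →L[ℝ] L2 n := cut.comp (reg.comp fourierL2)
  have hlow : ∀ f : L2 n, low f =ᵐ[volume] fun ξ => if freqSq ξ ≤ R then fourierL2 f ξ else 0 :=
    fun f => coeFn_cut_reg hR (fourierL2 f)
  let X : ℝ → Lp (ℂ × ℂ × ℂ) 2 (volume : Measure (Space n)) := fun s =>
    tripleL2 (low (φ s), low (φt s), low (T s))
  have hXξ : ∀ s, X s =ᵐ[volume] fun ξ => if freqSq ξ ≤ R then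
      (fourierL2 (φ s) ξ, fourierL2 (φt s) ξ, fourierL2 (T s) ξ) else 0 := by
    intro s
    filter_upwards [coeFn_tripleL2 (low (φ s)) (low (φt s)) (low (T s)), hlow (φ s),
      hlow (φt s), hlow (T s)] with ξ h1 h2 h3 h4
    rw [h1, h2, h3, h4]
    split_ifs <;> rfl
  have hXc : ContinuousOn X (Set.Ici 0) :=
    tripleL2.continuous.comp_continuousOn
      ((low.continuous.comp_continuousOn h.continuousOn_φ).prodMk
        ((low.continuous.comp_continuousOn h.continuousOn_φt).prodMk
          (low.continuous.comp_continuousOn h.continuousOn_T)))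
  have hXd : ∀ s, 0 < s → HasDerivAt X (M (X s)) s := by
    intro s hs
    have d₁ := low.hasFDerivAt.comp_hasDerivAt s (h.hasDerivAt_φ s hs)
    have d₂ := cut.hasFDerivAt.comp_hasDerivAt s (h.hasDerivAt_fourier_v hs)
    have d₃ := cut.hasFDerivAt.comp_hasDerivAt s (h.hasDerivAt_fourier_θ hs)
    have d := tripleL2.hasFDerivAt.comp_hasDerivAt s (d₁.prodMk (d₂.prodMk d₃))
    refine HasDerivAt.congr_deriv (f := X) d ?_
    simp only [map_sub, map_smul]
    set A := cut (mulL2 memLp_regLaplaceSymbol (fourierL2 (φ s)))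
    set B := cut (mulL2 memLp_regLaplaceSymbol (fourierL2 (φt s)))
    set C := cut (mulL2 memLp_regLaplaceSymbol (fourierL2 (T s)))
    set r := m.αp * m.c₀ ^ 2
    set p := (m.γ - 1) / m.αp
    set q := m.γ * m.Dth
    have hA : A =ᵐ[volume] _ := coeFn_cut_regLaplace hR (fourierL2 (φ s))
    have hB : B =ᵐ[volume] _ := coeFn_cut_regLaplace hR (fourierL2 (φt s))
    have hC : C =ᵐ[volume] _ := coeFn_cut_regLaplace hR (fourierL2 (T s))
    have hlast := coeFn_smul_sub_smul (-(m.c₀ ^ 2) • A - ((1 + m.β) * ν) • B)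
      (p • A - q • C) 1 r
    rw [one_smul] at hlast
    apply Lp.ext
    filter_upwards [coeFn_tripleL2 (low (φt s))
      (-(m.c₀ ^ 2) • A - ((1 + m.β) * ν) • B - r • (p • A - q • C)) (p • A - q • C),
      hM (X s), hXξ s, hlow (φt s), hA, hB, hC,
      coeFn_smul_sub_smul A B (-(m.c₀ ^ 2)) ((1 + m.β) * ν), coeFn_smul_sub_smul A C p q,
      hlast] with ξ h1 h2 h3 h4 h5 h6 h7 h8 h9 h10
    rw [h1, h2, h3, modeGenerator_apply, h4, h10, h9, h8, h5, h6, h7]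
    split_ifs with hξ
    · simp only [Complex.real_smul, r, p, q]
      push_cast
      refine Prod.ext rfl (Prod.ext ?_ ?_) <;> dsimp only <;> ring
    · simp
  have hexp : X t =ᵐ[volume] fun ξ =>
      NormedSpace.exp (t • modeGenerator m ν (cutFreqSq R ξ)) (X 0 ξ) := by
    rw [eq_exp_smul_apply M hXc hXd ht]
    exact exp_smul_apply_ae M (fun ξ => modeGenerator m ν (cutFreqSq R ξ)) hM t (X 0)
  filter_upwards [hexp, hXξ t, hXξ 0] with ξ h1 h2 h3 hξ
  rw [h2, h3, if_pos hξ, if_pos hξ, cutFreqSq, if_pos hξ] at h1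
  refine ⟨_, _, _, isMode_exp m ν (freqSq ξ)
    (fourierL2 (φ 0) ξ, fourierL2 (φt 0) ξ, fourierL2 (T 0) ξ), ?_⟩
  simp only [← h1, exp_zero_smul_apply, and_self]

/-- Almost every Fourier coefficient of a solution follows the mode equations. -/
theorem IsSolution.exists_isMode {m : Medium} {ν : ℝ} {φ₀ φ₁ T₀ : 𝓢'(Space n, ℂ)}
    {φ φt T : ℝ → L2 n} (h : IsSolution m ν φ₀ φ₁ T₀ φ φt T) {t : ℝ} (ht : 0 ≤ t) :
    ∀ᵐ ξ : Space n, ∃ u v θ : ℝ → ℂ, IsMode m ν (freqSq ξ) u v θ ∧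
      u 0 = fourierL2 (φ 0) ξ ∧ v 0 = fourierL2 (φt 0) ξ ∧ θ 0 = fourierL2 (T 0) ξ ∧
      u t = fourierL2 (φ t) ξ ∧ v t = fourierL2 (φt t) ξ ∧ θ t = fourierL2 (T t) ξ := by
  -- The cut-off levels run over the naturals, so that countably many null sets are discarded.
  filter_upwards [ae_all_iff.2 fun N : ℕ => h.exists_isMode_of_le N.cast_nonneg ht] with ξ hξ
  exact hξ ⌈freqSq ξ⌉₊ (Nat.le_ceil _)

/-! ### Sup norms and data norms through the Fourier transform. -/

/-- A distribution whose Fourier transform is a function `h` is bounded by `∫ |h|`. -/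
theorem distNorm_top_le_lintegral {u : 𝓢'(Space n, ℂ)} {h : Space n → ℂ}
    (hm : AEStronglyMeasurable h volume)
    (hu : ∀ η : 𝓢(Space n, ℂ), (𝓕 u) η = ∫ ξ, η ξ • h ξ) :
    distNorm ∞ u ≤ ∫⁻ ξ, ‖h ξ‖ₑ := by
  by_cases hfin : ∫⁻ ξ, ‖h ξ‖ₑ = ∞
  · rw [hfin]
    exact le_top
  have hint : Integrable h := ⟨hm, lt_top_iff_ne_top.2 hfin⟩
  have hcont : Continuous (𝓕⁻ h) := by
    rw [Real.fourierInv_eq_fourier_comp_neg]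
    exact VectorFourier.fourierIntegral_continuous Real.continuous_fourierChar
      (innerSL ℝ).continuous₂ hint.comp_neg
  have hbound : ∀ x, ‖(𝓕⁻ h) x‖ ≤ ∫ ξ, ‖h ξ‖ := fun x =>
    VectorFourier.norm_fourierIntegral_le_integral_norm _ _ _ _ _
  have hL : MemLp (𝓕⁻ h) ∞ volume :=
    memLp_top_of_bound hcont.aestronglyMeasurable _ (Eventually.of_forall hbound)
  have hrep : ((hL.toLp (𝓕⁻ h) : Lp ℂ ∞ (volume : Measure (Space n))) : 𝓢'(Space n, ℂ)) = u := by
    ext χ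
    rw [Lp.toTemperedDistribution_apply]
    have e1 : u χ = (𝓕 u) (𝓕⁻ χ) := by
      rw [TemperedDistribution.fourier_apply, FourierTransform.fourier_fourierInv_eq]
    rw [e1, hu]
    -- The inverse transform is moved between `χ` and `h` by Fubini; the sign of the pairing makes
    -- it the inverse one.
    have e2 := VectorFourier.integral_fourierIntegral_smul_eq_flip (f := (χ : Space n → ℂ)) (g := h)
      (L := -innerₗ (Space n)) (μ := volume) (ν := volume)
      Real.continuous_fourierChar (by simpa using continuous_inner.fun_neg) χ.integrable hint
    have e3 : (-innerₗ (Space n)).flip = -innerₗ (Space n) := by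
      ext x y
      simp [real_inner_comm]
    rw [e3] at e2
    calc ∫ x, χ x • (hL.toLp (𝓕⁻ h)) x = ∫ x, χ x • (𝓕⁻ h) x := by
          apply integral_congr_ae
          filter_upwards [hL.coeFn_toLp] with x hx
          rw [hx]
      _ = ∫ ξ, (𝓕⁻ (χ : Space n → ℂ)) ξ • h ξ := e2.symm
      _ = _ := by rw [SchwartzMap.fourierInv_coe]
  calc distNorm ∞ u ≤ ‖(hL.toLp (𝓕⁻ h) : Lp ℂ ∞ (volume : Measure (Space n)))‖ₑ :=
        iInf₂_le (hL.toLp (𝓕⁻ h)) hrep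
    _ = eLpNorm (𝓕⁻ h) ∞ volume := Lp.enorm_toLp ..
    _ ≤ ENNReal.ofReal (∫ ξ, ‖h ξ‖) := by
        rw [eLpNorm_exponent_top]
        refine eLpNormEssSup_le_of_ae_bound (Eventually.of_forall hbound)
    _ = ∫⁻ ξ, ‖h ξ‖ₑ := ofReal_integral_norm_eq_lintegral_enorm hint

theorem exists_enorm_eq_distNorm {p : ℝ≥0∞} [Fact (1 ≤ p)] {u : 𝓢'(Space n, ℂ)}
    (hu : distNorm p u ≠ ∞) :
    ∃ f : Lp ℂ p (volume : Measure (Space n)), (f : 𝓢'(Space n, ℂ)) = u ∧ ‖f‖ₑ = distNorm p u := by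
  by_cases h : ∃ f : Lp ℂ p (volume : Measure (Space n)), (f : 𝓢'(Space n, ℂ)) = u
  · obtain ⟨f, hf⟩ := h
    refine ⟨f, hf, le_antisymm (le_iInf₂ fun g hg => ?_) (iInf₂_le f hf)⟩
    rw [toTemperedDistribution_injective (hf.trans hg.symm)]
  · refine absurd ?_ hu
    push Not at h
    exact iInf₂_eq_top.2 fun f hf => absurd hf (h f)

/-- Locally integrable functions that agree as tempered distributions agree almost everywhere. -/
theorem ae_eq_of_forall_schwartz {f g : Space n → ℂ} (hf : LocallyIntegrable f)
    (hg : LocallyIntegrable g)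
    (h : ∀ η : 𝓢(Space n, ℂ), ∫ ξ, η ξ • f ξ = ∫ ξ, η ξ • g ξ) : f =ᵐ[volume] g := by
  refine ae_eq_of_integral_contDiff_smul_eq hf hg fun η hη hc => ?_
  have h1 : HasCompactSupport (Complex.ofRealCLM ∘ η) := hc.comp_left rfl
  have h2 : ContDiff ℝ (⊤ : ℕ∞) (Complex.ofRealCLM ∘ η) := by fun_prop
  simpa using h (h1.toSchwartzMap h2)

theorem japaneseSymbol_eq (r : ℝ) (ξ : Space n) :
    japaneseSymbol n r ξ = (((1 + freqSq ξ) ^ (r / 2) : ℝ) : ℂ) := rfl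

/-- Pointwise bound for the Fourier transform of a function in a Bessel potential space over `L¹`. -/
theorem norm_fourier_le_of_japaneseD {u : L2 n} {r : ℝ} {f : Lp ℂ 1 (volume : Measure (Space n))}
    (hf : (f : 𝓢'(Space n, ℂ)) = japaneseD r (u : 𝓢'(Space n, ℂ))) :
    ∀ᵐ ξ : Space n, ‖fourierL2 u ξ‖ ≤ (1 + freqSq ξ) ^ (-(r / 2)) * ‖f‖ := by
  have hfint : Integrable (f : Space n → ℂ) := L1.integrable_coeFn f
  have hsym := japaneseSymbol_hasTemperateGrowth n r
  have hcont : Continuous (𝓕 (f : Space n → ℂ)) :=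
    VectorFourier.fourierIntegral_continuous Real.continuous_fourierChar
      (innerSL ℝ).continuous₂ hfint
  have hae : (fun ξ => japaneseSymbol n r ξ * fourierL2 u ξ) =ᵐ[volume] 𝓕 (f : Space n → ℂ) := by
    refine ae_eq_of_forall_schwartz ?_ hcont.locallyIntegrable fun η => ?_
    · exact ((Lp.memLp (fourierL2 u)).locallyIntegrable (by norm_num)).continuous_mul
        hsym.1.continuous
    have e1 : (𝓕 (f : 𝓢'(Space n, ℂ))) η = ∫ ξ, η ξ • (japaneseSymbol n r ξ * fourierL2 u ξ) := by
      rw [hf, japaneseD, TemperedDistribution.fourierMultiplierCLM_apply,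
        FourierTransform.fourier_fourierInv_eq, Lp.fourier_toTemperedDistribution_eq,
        TemperedDistribution.smulLeftCLM_apply_apply, Lp.toTemperedDistribution_apply]
      congr 1
      funext ξ
      rw [SchwartzMap.smulLeftCLM_apply_apply hsym]
      change (japaneseSymbol n r ξ • η ξ) • fourierL2 u ξ = _
      simp only [smul_eq_mul]
      ring
    have e2 : (𝓕 (f : 𝓢'(Space n, ℂ))) η = ∫ ξ, η ξ • (𝓕 (f : Space n → ℂ)) ξ := by
      rw [TemperedDistribution.fourier_apply, Lp.toTemperedDistribution_apply,
        SchwartzMap.fourier_coe]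
      simpa using! VectorFourier.integral_fourierIntegral_smul_eq_flip (f := (η : Space n → ℂ))
        (g := f) (L := innerₗ (Space n)) (μ := volume) (ν := volume)
        Real.continuous_fourierChar continuous_inner η.integrable hfint
    rw [← e1, e2]
  filter_upwards [hae] with ξ hξ
  have hpos : 0 < 1 + freqSq ξ := by linarith [freqSq_nonneg ξ]
  have h1 : ‖(𝓕 (f : Space n → ℂ)) ξ‖ ≤ ‖f‖ := by
    rw [L1.norm_eq_integral_norm]
    exact VectorFourier.norm_fourierIntegral_le_integral_norm _ _ _ _ _
  rw [← hξ, norm_mul, japaneseSymbol_eq, Complex.norm_real, Real.norm_of_nonneg (by positivity)] at h1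
  rw [Real.rpow_neg hpos.le, ← div_eq_inv_mul, le_div_iff₀ (by positivity)]
  linarith

theorem japaneseD_japaneseD (r q : ℝ) (u : 𝓢'(Space n, ℂ)) :
    japaneseD r (japaneseD q u) = japaneseD (r + q) u := by
  rw [japaneseD, japaneseD, TemperedDistribution.fourierMultiplierCLM_fourierMultiplierCLM_apply
    (japaneseSymbol_hasTemperateGrowth n q) (japaneseSymbol_hasTemperateGrowth n r), japaneseD]
  congr 1
  congr 1
  funext ξ
  have hpos : 0 < 1 + freqSq ξ := by linarith [freqSq_nonneg ξ]
  rw [Pi.mul_apply, japaneseSymbol_eq, japaneseSymbol_eq, japaneseSymbol_eq, ← Complex.ofReal_mul,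
    ← Real.rpow_add hpos]
  congr 2
  ring

theorem fourier_apply_eq_integral (w : L2 n) (η : 𝓢(Space n, ℂ)) :
    (𝓕 (w : 𝓢'(Space n, ℂ))) η = ∫ ξ, η ξ • fourierL2 w ξ := by
  rw [Lp.fourier_toTemperedDistribution_eq, Lp.toTemperedDistribution_apply]
  rfl

theorem fourier_laplacian_apply_eq_integral (w : L2 n) (η : 𝓢(Space n, ℂ)) :
    (𝓕 (Δ (w : 𝓢'(Space n, ℂ)))) η
      = ∫ ξ, η ξ • (-((freqSq ξ : ℝ) : ℂ) * fourierL2 w ξ) := by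
  have h : (𝓕 (Δ (w : 𝓢'(Space n, ℂ)))) η
      = -(𝓕 (w : 𝓢'(Space n, ℂ))) (SchwartzMap.smulLeftCLM ℂ (fun ξ => ((freqSq ξ : ℝ) : ℂ)) η) := by
    rw [fourier_laplacian]
    rfl
  rw [h, fourier_apply_eq_integral, ← integral_neg]
  congr 1
  funext ξ
  rw [SchwartzMap.smulLeftCLM_apply_apply freqSq_hasTemperateGrowth]
  simp only [smul_eq_mul]
  ring

/-! ### The integrable weight and pointwise bounds in frequency. -/

/-- The weight dominating all Fourier transforms in the final estimate. -/
noncomputable def weight (s : ℝ) (ξ : Space n) : ℝ := ‖ξ‖⁻¹ * (1 + freqSq ξ) ^ ((2 - s) / 2)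

theorem norm_sq_le_freqSq (ξ : Space n) : ‖ξ‖ ^ 2 ≤ freqSq ξ := by
  rw [freqSq_eq]
  refine le_mul_of_one_le_left (sq_nonneg _) ?_
  nlinarith [Real.pi_gt_three]

theorem weight_nonneg (s : ℝ) (ξ : Space n) : 0 ≤ weight s ξ := by
  have := freqSq_nonneg ξ
  unfold weight
  positivity

theorem integrable_weight (hn : 2 ≤ n) {s : ℝ} (hs : (n : ℝ) + 2 < s) :
    Integrable (weight s : Space n → ℝ) := by
  have hfin : Module.finrank ℝ (Space n) = n := by simp
  have : Nonempty (Fin n) := ⟨⟨0, by omega⟩⟩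
  have h1 : Integrable (fun ξ : Space n => ((1 : ℝ) + ‖ξ‖ ^ 2) ^ (-(s - 2) / 2)) :=
    integrable_rpow_neg_one_add_norm_sq (by rw [hfin]; linarith)
  -- In polar coordinates the integrand is `y^(n-2)`, bounded on `(0, 1)` because `n ≥ 2`.
  have h2 : IntegrableOn (fun ξ : Space n => ‖ξ‖⁻¹) (Metric.ball 0 1) := by
    rw [integrableOn_fun_norm_addHaar volume (f := fun y => y⁻¹), hfin]
    refine Measure.integrableOn_of_bounded (M := 1) (by simp) (by fun_prop) ?_
    filter_upwards [ae_restrict_mem measurableSet_Ioo] with y hy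
    obtain ⟨k, rfl⟩ := Nat.exists_eq_add_of_le hn
    have : y ^ (2 + k - 1) • y⁻¹ = y ^ k := by
      rw [show 2 + k - 1 = k + 1 by omega, pow_succ, smul_eq_mul, mul_assoc,
        mul_inv_cancel₀ hy.1.ne', mul_one]
    rw [this, Real.norm_of_nonneg (pow_nonneg hy.1.le k)]
    exact pow_le_one₀ hy.1.le hy.2.le
  have h3 := h1.add (h2.integrable_indicator measurableSet_ball)
  refine h3.mono' ?_ (Eventually.of_forall fun ξ => ?_)
  · unfold weight
    have := continuous_freqSq (n := n)
    exact (Measurable.mul (by fun_prop)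
      ((continuous_freqSq.measurable.const_add 1).pow_const _)).aestronglyMeasurable
  · have hK := freqSq_nonneg ξ
    have hneg : (2 - s) / 2 ≤ 0 := by
      have : (0 : ℝ) ≤ n := n.cast_nonneg
      linarith
    rw [Real.norm_of_nonneg (weight_nonneg s ξ), Pi.add_apply, weight]
    by_cases hξ : ξ ∈ Metric.ball (0 : Space n) 1
    · rw [Set.indicator_of_mem hξ]
      have e1 : (1 + freqSq ξ) ^ ((2 - s) / 2) ≤ 1 :=
        Real.rpow_le_one_of_one_le_of_nonpos (by linarith) hneg
      have e2 : ‖ξ‖⁻¹ * (1 + freqSq ξ) ^ ((2 - s) / 2) ≤ ‖ξ‖⁻¹ :=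
        mul_le_of_le_one_right (by positivity) e1
      have e3 : 0 ≤ ((1 : ℝ) + ‖ξ‖ ^ 2) ^ (-(s - 2) / 2) := by positivity
      linarith
    · rw [Set.indicator_of_notMem hξ, add_zero]
      have e0 : 1 ≤ ‖ξ‖ := by simpa using hξ
      have e1 : (1 + freqSq ξ) ^ ((2 - s) / 2) ≤ (1 + ‖ξ‖ ^ 2) ^ ((2 - s) / 2) :=
        Real.rpow_le_rpow_of_nonpos (by positivity) (by linarith [norm_sq_le_freqSq ξ]) hneg
      have e2 : ‖ξ‖⁻¹ * (1 + freqSq ξ) ^ ((2 - s) / 2) ≤ (1 + freqSq ξ) ^ ((2 - s) / 2) :=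
        mul_le_of_le_one_left (by positivity) (inv_le_one_of_one_le₀ e0)
      rw [show -(s - 2) / 2 = (2 - s) / 2 by ring]
      exact e2.trans e1

/-- A data bound turns the mode energy estimate into a pointwise bound. -/
theorem le_of_mode_energy {C ν K r N₀ N₁ N₂ Y W Z U V Θ : ℝ} (hK : 0 ≤ K) (hC : 0 ≤ C)
    (hν : 0 ≤ ν) (hN₀ : 0 ≤ N₀) (hN₁ : 0 ≤ N₁) (hN₂ : 0 ≤ N₂)
    (hU0 : 0 ≤ U) (hV0 : 0 ≤ V) (hΘ0 : 0 ≤ Θ)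
    (h : Y ^ 2 + K * W ^ 2 + K * Z ^ 2 ≤ C * ν * (1 + K) * (V ^ 2 + K * U ^ 2 + K * Θ ^ 2))
    (hU : U ≤ (1 + K) ^ (-((r + 1) / 2)) * N₀) (hV : V ≤ (1 + K) ^ (-(r / 2)) * N₁)
    (hΘ : Θ ≤ (1 + K) ^ (-(r / 2)) * N₂) :
    ∀ X, X ^ 2 ≤ Y ^ 2 + K * W ^ 2 + K * Z ^ 2 →
      X ≤ √(C * ν) * (N₀ + N₁ + N₂) * (1 + K) ^ ((2 - r) / 2) := by
  have hpos : 0 < 1 + K := by linarith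
  set J := (1 + K) ^ (-(r / 2)) with hJ
  have hJ0 : 0 < J := by positivity
  set H := (1 + K) ^ (-(1 / 2) : ℝ) with hH
  have hH0 : 0 < H := by positivity
  have hH2 : H ^ 2 * (1 + K) = 1 := by
    rw [hH, ← Real.rpow_natCast, ← Real.rpow_mul hpos.le]
    norm_num [Real.rpow_neg_one]
    exact inv_mul_cancel₀ hpos.ne'
  have hJH : (1 + K) ^ (-((r + 1) / 2)) = J * H := by
    rw [hJ, hH, ← Real.rpow_add hpos]
    congr 1
    ring
  -- One factor `√(1+K)` comes from the energy estimate, the other from the weight `K` in the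
  -- initial energy.
  have hgoal : (1 + K) ^ ((2 - r) / 2) = (1 + K) * J := by
    rw [hJ, show (2 - r) / 2 = 1 + -(r / 2) by ring, Real.rpow_add hpos, Real.rpow_one]
  have sq_le : ∀ {x y : ℝ}, 0 ≤ x → x ≤ y → x ^ 2 ≤ y ^ 2 := fun hx hxy => pow_le_pow_left₀ hx hxy 2
  have hV2 : V ^ 2 ≤ (1 + K) * (J * N₁) ^ 2 := by
    have := sq_le hV0 hV
    have h0 := mul_nonneg hK (sq_nonneg (J * N₁))
    linarith
  have hΘ2 : K * Θ ^ 2 ≤ (1 + K) * (J * N₂) ^ 2 := by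
    have := mul_le_mul_of_nonneg_left (sq_le hΘ0 hΘ) hK
    have h0 := sq_nonneg (J * N₂)
    linarith
  have hU2 : K * U ^ 2 ≤ (1 + K) * (J * N₀) ^ 2 := by
    rw [hJH] at hU
    have e1 := sq_le hU0 hU
    have e2 : U ^ 2 ≤ (J * N₀) ^ 2 := by
      have : H ^ 2 ≤ 1 := by nlinarith [mul_nonneg hK (sq_nonneg H)]
      calc U ^ 2 ≤ H ^ 2 * (J * N₀) ^ 2 := by linarith
        _ ≤ 1 * (J * N₀) ^ 2 := mul_le_mul_of_nonneg_right this (sq_nonneg _)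
        _ = _ := one_mul _
    have := mul_le_mul_of_nonneg_left e2 hK
    have h0 := sq_nonneg (J * N₀)
    linarith
  have hsum : V ^ 2 + K * U ^ 2 + K * Θ ^ 2 ≤ (1 + K) * (J * (N₀ + N₁ + N₂)) ^ 2 := by
    have : 0 ≤ (1 + K) * J ^ 2 * (2 * (N₀ * N₁ + N₀ * N₂ + N₁ * N₂)) := by positivity
    linarith
  intro X hX
  rw [hgoal]
  refine (abs_le_of_sq_le_sq' ?_ (by positivity)).2
  calc X ^ 2 ≤ C * ν * (1 + K) * ((1 + K) * (J * (N₀ + N₁ + N₂)) ^ 2) :=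
        (hX.trans h).trans (mul_le_mul_of_nonneg_left hsum (by positivity))
    _ = √(C * ν) ^ 2 * ((N₀ + N₁ + N₂) * ((1 + K) * J)) ^ 2 := by
        rw [Real.sq_sqrt (by positivity)]
        ring
    _ = _ := by ring

/-- The constant does not depend on `r`, so `r = s + 2` and `r = s` serve the two estimates of the
theorem. -/
theorem norm_fourier_sub_le (m : Medium) :
    ∃ C : ℝ, 0 < C ∧ ∀ (r ν : ℝ), 0 ≤ ν →
      ∀ (φ₀ φ₁ T₀ : 𝓢'(Space n, ℂ)) (φ φt T φ' φt' T' : ℝ → L2 n),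
      IsSolution m ν φ₀ φ₁ T₀ φ φt T → IsSolution m 0 φ₀ φ₁ T₀ φ' φt' T' →
      ∀ f₀ f₁ f₂ : Lp ℂ 1 (volume : Measure (Space n)),
      (f₀ : 𝓢'(Space n, ℂ)) = japaneseD (r + 1) φ₀ → (f₁ : 𝓢'(Space n, ℂ)) = japaneseD r φ₁ →
      (f₂ : 𝓢'(Space n, ℂ)) = japaneseD r T₀ → ∀ t, 0 ≤ t → ∀ᵐ ξ : Space n,
      let B := √ν * (C * (‖f₀‖ + ‖f₁‖ + ‖f₂‖)) * (1 + freqSq ξ) ^ ((2 - r) / 2)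
      ‖fourierL2 (φt t - φt' t) ξ‖ ≤ B ∧ √(freqSq ξ) * ‖fourierL2 (φ t - φ' t) ξ‖ ≤ B ∧
        √(freqSq ξ) * ‖fourierL2 (T t - T' t) ξ‖ ≤ B := by
  obtain ⟨C, hC, H⟩ := IsMode.norm_sub_sq_le m
  refine ⟨√C, Real.sqrt_pos.2 hC, ?_⟩
  intro r ν hν φ₀ φ₁ T₀ φ φt T φ' φt' T' h h' f₀ f₁ f₂ hf₀ hf₁ hf₂ t ht
  have sub : ∀ a b : L2 n, fourierL2 (a - b) =ᵐ[volume] fun ξ => fourierL2 a ξ - fourierL2 b ξ := by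
    intro a b
    rw [map_sub]
    exact Lp.coeFn_sub _ _
  have hφ0 : φ 0 = φ' 0 := toTemperedDistribution_injective (h.init_φ.trans h'.init_φ.symm)
  have hφt0 : φt 0 = φt' 0 := toTemperedDistribution_injective (h.init_φt.trans h'.init_φt.symm)
  have hT0 : T 0 = T' 0 := toTemperedDistribution_injective (h.init_T.trans h'.init_T.symm)
  rw [← h'.init_φ] at hf₀
  rw [← h'.init_φt] at hf₁
  rw [← h'.init_T] at hf₂
  filter_upwards [h.exists_isMode ht, h'.exists_isMode ht, norm_fourier_le_of_japaneseD hf₀,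
    norm_fourier_le_of_japaneseD hf₁, norm_fourier_le_of_japaneseD hf₂, sub (φ t) (φ' t),
    sub (φt t) (φt' t), sub (T t) (T' t)] with ξ h1 h2 h3 h4 h5 h6 h7 h8
  obtain ⟨u, v, θ, hm, hu0, hv0, hθ0, hut, hvt, hθt⟩ := h1
  obtain ⟨u', v', θ', hm', hu0', hv0', hθ0', hut', hvt', hθt'⟩ := h2
  have hK := freqSq_nonneg ξ
  have key := H ν (freqSq ξ) hν hK u v θ u' v' θ' hm hm' (by rw [hu0, hu0', hφ0])
    (by rw [hv0, hv0', hφt0]) (by rw [hθ0, hθ0', hT0]) t ht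
  rw [hut, hvt, hθt, hut', hvt', hθt', hu0', hv0', hθ0', ← h6, ← h7, ← h8] at key
  have hB := le_of_mode_energy hK hC.le hν (norm_nonneg f₀) (norm_nonneg f₁) (norm_nonneg f₂)
    (norm_nonneg _) (norm_nonneg _) (norm_nonneg _) key h3 h4 h5
  have e : √(C * ν) * (‖f₀‖ + ‖f₁‖ + ‖f₂‖) = √ν * (√C * (‖f₀‖ + ‖f₁‖ + ‖f₂‖)) := by
    rw [Real.sqrt_mul hC.le]
    ring
  rw [e] at hB
  have a1 := mul_nonneg hK (sq_nonneg ‖fourierL2 (φ t - φ' t) ξ‖)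
  have a2 := mul_nonneg hK (sq_nonneg ‖fourierL2 (T t - T' t) ξ‖)
  have a3 := sq_nonneg ‖fourierL2 (φt t - φt' t) ξ‖
  refine ⟨hB _ (by linarith), hB _ ?_, hB _ ?_⟩
  · rw [mul_pow, Real.sq_sqrt hK]
    linarith
  · rw [mul_pow, Real.sq_sqrt hK]
    linarith

theorem distNorm_top_le_of_weight {u : 𝓢'(Space n, ℂ)} {h : Space n → ℂ} {s A : ℝ} (hA : 0 ≤ A)
    (hn : 2 ≤ n) (hs : (n : ℝ) + 2 < s)
    (hm : AEStronglyMeasurable h volume)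
    (hu : ∀ η : 𝓢(Space n, ℂ), (𝓕 u) η = ∫ ξ, η ξ • h ξ)
    (hb : ∀ᵐ ξ, ‖h ξ‖ ≤ A * weight s ξ) :
    distNorm ∞ u ≤ ENNReal.ofReal (A * ∫ ξ : Space n, weight s ξ) := by
  refine (distNorm_top_le_lintegral hm hu).trans ?_
  rw [← integral_const_mul, ofReal_integral_eq_lintegral_ofReal
    ((integrable_weight hn hs).const_mul A)
    (Eventually.of_forall fun ξ => mul_nonneg hA (weight_nonneg s ξ))]
  refine lintegral_mono_ae ?_
  filter_upwards [hb] with ξ hξ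
  rw [← ofReal_norm]
  exact ENNReal.ofReal_le_ofReal hξ

/-- The four bounds serve `φ_t`, `Δφ` and `T` with `r = s + 2`, and `φ` with `r = s`. The energy
controls `√K` times the coefficients of `φ` and `T`; dividing by `√K` produces the singularity at
the origin. -/
theorem rpow_le_weight {s : ℝ} {ξ : Space n} (hξ : ξ ≠ 0) :
    (1 + freqSq ξ) ^ ((2 - (s + 2)) / 2) ≤ weight s ξ ∧
    √(freqSq ξ) * (1 + freqSq ξ) ^ ((2 - (s + 2)) / 2) ≤ weight s ξ ∧
    (√(freqSq ξ))⁻¹ * (1 + freqSq ξ) ^ ((2 - (s + 2)) / 2) ≤ weight s ξ ∧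
    (√(freqSq ξ))⁻¹ * (1 + freqSq ξ) ^ ((2 - s) / 2) ≤ weight s ξ := by
  have hK := freqSq_nonneg ξ
  have hpos : 0 < 1 + freqSq ξ := by linarith
  have hn : 0 < ‖ξ‖ := norm_pos_iff.2 hξ
  set k := √(freqSq ξ) with hk
  have hk2 : k ^ 2 = freqSq ξ := Real.sq_sqrt hK
  have hnk : ‖ξ‖ ≤ k := Real.le_sqrt_of_sq_le (norm_sq_le_freqSq ξ)
  have hk0 : 0 < k := hn.trans_le hnk
  have hinv : k⁻¹ ≤ ‖ξ‖⁻¹ := inv_anti₀ hn hnk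
  set P := (1 + freqSq ξ) ^ ((2 - s) / 2) with hP
  have hP0 : 0 < P := by positivity
  have hQ : (1 + freqSq ξ) ^ ((2 - (s + 2)) / 2) = P * (1 + freqSq ξ)⁻¹ := by
    rw [hP, ← Real.rpow_neg_one, ← Real.rpow_add hpos]
    congr 1
    ring
  have hw : k⁻¹ * P ≤ weight s ξ := mul_le_mul_of_nonneg_right hinv hP0.le
  rw [hQ, ← hk2]
  refine ⟨?_, ?_, ?_, hw⟩ <;> refine le_trans ?_ hw
  · have : (1 + k ^ 2)⁻¹ ≤ k⁻¹ := inv_anti₀ hk0 (by nlinarith)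
    nlinarith
  · have : k * (1 + k ^ 2)⁻¹ ≤ k⁻¹ := by
      rw [← div_eq_mul_inv, div_le_iff₀ (by positivity)]
      have : k⁻¹ * (1 + k ^ 2) = k⁻¹ + k := by field_simp
      rw [this]
      linarith [inv_pos.2 hk0]
    nlinarith
  · have : P * (1 + k ^ 2)⁻¹ ≤ P :=
      mul_le_of_le_one_right hP0.le (inv_le_one_of_one_le₀ (by nlinarith))
    exact mul_le_mul_of_nonneg_left this (inv_pos.2 hk0).le

/-- If some data norm is infinite, so is the right side, since `A > 0`. Otherwise each norm is
attained at the unique representative. -/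
theorem le_ofReal_mul_distNorm_sum {X : ℝ≥0∞} {A : ℝ} (hA : 0 < A) {u₀ u₁ u₂ : 𝓢'(Space n, ℂ)}
    (h : ∀ f₀ f₁ f₂ : Lp ℂ 1 (volume : Measure (Space n)), (f₀ : 𝓢'(Space n, ℂ)) = u₀ →
      (f₁ : 𝓢'(Space n, ℂ)) = u₁ → (f₂ : 𝓢'(Space n, ℂ)) = u₂ →
      X ≤ ENNReal.ofReal (A * (‖f₀‖ + ‖f₁‖ + ‖f₂‖))) :
    X ≤ ENNReal.ofReal A * (distNorm 1 u₀ + distNorm 1 u₁ + distNorm 1 u₂) := by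
  by_cases hfin : distNorm 1 u₀ + distNorm 1 u₁ + distNorm 1 u₂ = ∞
  · rw [hfin, ENNReal.mul_top (by simpa using hA)]
    exact le_top
  · rw [ENNReal.add_eq_top, ENNReal.add_eq_top] at hfin
    push Not at hfin
    obtain ⟨f₀, hf₀, e₀⟩ := exists_enorm_eq_distNorm hfin.1.1
    obtain ⟨f₁, hf₁, e₁⟩ := exists_enorm_eq_distNorm hfin.1.2
    obtain ⟨f₂, hf₂, e₂⟩ := exists_enorm_eq_distNorm hfin.2
    refine (h f₀ f₁ f₂ hf₀ hf₁ hf₂).trans_eq ?_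
    rw [← e₀, ← e₁, ← e₂, ENNReal.ofReal_mul hA.le, ENNReal.ofReal_add (by positivity)
      (norm_nonneg _), ENNReal.ofReal_add (norm_nonneg _) (norm_nonneg _), ofReal_norm,
      ofReal_norm, ofReal_norm]

end ThermoAcoustic

/-! ### Assembly of the two estimates. -/

open ThermoAcoustic in
theorem theorem2p4 (n : ℕ) (hn : 2 ≤ n) (s : ℝ) (hs : (n : ℝ) + 2 < s) (m : Medium) :
    ∃ C : ℝ, 0 < C ∧
      ∀ (φ₀ φ₁ T₀ : 𝓢'(Space n, ℂ)),
        IsLp 1 (japaneseD (s + 3) φ₀) →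
        IsLp 1 (japaneseD (s + 2) φ₁) →
        IsLp 1 (japaneseD (s + 2) T₀) →
      ∀ ν₀ : ℝ, 0 < ν₀ →
      ∀ (φ φt T : ℝ → L2 n), IsSolution m ν₀ φ₀ φ₁ T₀ φ φt T →
      ∀ (φ' φt' T' : ℝ → L2 n), IsSolution m 0 φ₀ φ₁ T₀ φ' φt' T' →
        (⨆ t ∈ Set.Ici (0 : ℝ),
            (distNorm ∞ ((φt t - φt' t : L2 n) : 𝓢'(Space n, ℂ))
              + distNorm ∞ (Δ ((φ t - φ' t : L2 n) : 𝓢'(Space n, ℂ)))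
              + distNorm ∞ ((T t - T' t : L2 n) : 𝓢'(Space n, ℂ))))
          ≤ ENNReal.ofReal (C * √ν₀) *
            (distNorm 1 (japaneseD (s + 2) (japaneseD 1 φ₀))
              + distNorm 1 (japaneseD (s + 2) φ₁)
              + distNorm 1 (japaneseD (s + 2) T₀)) ∧
        (⨆ t ∈ Set.Ici (0 : ℝ), distNorm ∞ ((φ t - φ' t : L2 n) : 𝓢'(Space n, ℂ)))
          ≤ ENNReal.ofReal (C * √ν₀) *
            (distNorm 1 (japaneseD s (japaneseD 1 φ₀))
              + distNorm 1 (japaneseD s φ₁)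
              + distNorm 1 (japaneseD s T₀)) := by
  obtain ⟨C, hC, H⟩ := norm_fourier_sub_le (n := n) m
  set I := ∫ ξ : Space n, weight s ξ with hI
  have hI0 : 0 ≤ I := integral_nonneg fun ξ => weight_nonneg s ξ
  -- The `3` counts the summands of the first estimate; `I + 1` replaces `I` to make positivity
  -- immediate.
  refine ⟨3 * C * (I + 1), by positivity, ?_⟩
  intro φ₀ φ₁ T₀ _ _ _ ν hν φ φt T h φ' φt' T' h'
  have hne : ∀ᵐ ξ : Space n, ξ ≠ 0 := by
    have : Nonempty (Fin n) := ⟨⟨0, by omega⟩⟩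
    exact Measure.ae_ne volume 0
  have hν' : 0 < √ν := Real.sqrt_pos.2 hν
  refine ⟨iSup₂_le fun t ht => le_ofReal_mul_distNorm_sum (by positivity) ?_,
    iSup₂_le fun t ht => le_ofReal_mul_distNorm_sum (by positivity) ?_⟩
  all_goals
    intro f₀ f₁ f₂ hf₀ hf₁ hf₂
    rw [japaneseD_japaneseD] at hf₀
    have hb := H _ ν hν.le φ₀ φ₁ T₀ φ φt T φ' φt' T' h h' f₀ f₁ f₂ hf₀ hf₁ hf₂ t ht
    set N := ‖f₀‖ + ‖f₁‖ + ‖f₂‖ with hN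
    have hN0 : 0 ≤ N := by positivity
    set A := √ν * (C * N) with hA
    have hA0 : 0 ≤ A := by positivity
  · have b1 : distNorm ∞ ((φt t - φt' t : L2 n) : 𝓢'(Space n, ℂ)) ≤ ENNReal.ofReal (A * I) := by
      refine distNorm_top_le_of_weight hA0 hn hs (Lp.aestronglyMeasurable _)
        (fourier_apply_eq_integral _) ?_
      filter_upwards [hb, hne] with ξ hξ hξ0
      exact hξ.1.trans (mul_le_mul_of_nonneg_left (rpow_le_weight hξ0).1 hA0)
    have b2 : distNorm ∞ (Δ ((φ t - φ' t : L2 n) : 𝓢'(Space n, ℂ))) ≤ ENNReal.ofReal (A * I) := by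
      refine distNorm_top_le_of_weight hA0 hn hs
        (AEStronglyMeasurable.mul ?_ (Lp.aestronglyMeasurable _))
        (fourier_laplacian_apply_eq_integral _) ?_
      · exact (Complex.continuous_ofReal.comp continuous_freqSq).neg.aestronglyMeasurable
      filter_upwards [hb, hne] with ξ hξ hξ0
      have hK := freqSq_nonneg ξ
      rw [Pi.mul_apply, norm_mul, norm_neg, Complex.norm_real, Real.norm_of_nonneg hK]
      calc freqSq ξ * ‖fourierL2 (φ t - φ' t) ξ‖
          = √(freqSq ξ) * (√(freqSq ξ) * ‖fourierL2 (φ t - φ' t) ξ‖) := by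
            rw [← mul_assoc, Real.mul_self_sqrt hK]
        _ ≤ √(freqSq ξ) * (A * (1 + freqSq ξ) ^ ((2 - (s + 2)) / 2)) :=
            mul_le_mul_of_nonneg_left hξ.2.1 (Real.sqrt_nonneg _)
        _ = A * (√(freqSq ξ) * (1 + freqSq ξ) ^ ((2 - (s + 2)) / 2)) := by ring
        _ ≤ _ := mul_le_mul_of_nonneg_left (rpow_le_weight hξ0).2.1 hA0
    have b3 : distNorm ∞ ((T t - T' t : L2 n) : 𝓢'(Space n, ℂ)) ≤ ENNReal.ofReal (A * I) := by
      refine distNorm_top_le_of_weight hA0 hn hs (Lp.aestronglyMeasurable _)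
        (fourier_apply_eq_integral _) ?_
      filter_upwards [hb, hne] with ξ hξ hξ0
      have hk : 0 < √(freqSq ξ) := Real.sqrt_pos.2
        ((sq_pos_of_pos (norm_pos_iff.2 hξ0)).trans_le (norm_sq_le_freqSq ξ))
      have := (le_div_iff₀' hk).2 hξ.2.2
      refine this.trans (le_trans (le_of_eq ?_)
        (mul_le_mul_of_nonneg_left (rpow_le_weight hξ0).2.2.1 hA0))
      ring
    calc _ ≤ ENNReal.ofReal (A * I) + ENNReal.ofReal (A * I) + ENNReal.ofReal (A * I) :=
          add_le_add (add_le_add b1 b2) b3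
      _ = ENNReal.ofReal (A * I + A * I + A * I) := by
          rw [ENNReal.ofReal_add (by positivity) (by positivity),
            ENNReal.ofReal_add (by positivity) (by positivity)]
      _ ≤ _ := by
          refine ENNReal.ofReal_le_ofReal ?_
          rw [hA]
          have : 0 ≤ √ν * (C * N) := hA0
          linarith
  · have b : distNorm ∞ ((φ t - φ' t : L2 n) : 𝓢'(Space n, ℂ)) ≤ ENNReal.ofReal (A * I) := by
      refine distNorm_top_le_of_weight hA0 hn hs (Lp.aestronglyMeasurable _)
        (fourier_apply_eq_integral _) ?_
      filter_upwards [hb, hne] with ξ hξ hξ0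
      have hk : 0 < √(freqSq ξ) := Real.sqrt_pos.2
        ((sq_pos_of_pos (norm_pos_iff.2 hξ0)).trans_le (norm_sq_le_freqSq ξ))
      have := (le_div_iff₀' hk).2 hξ.2.1
      refine this.trans (le_trans (le_of_eq ?_)
        (mul_le_mul_of_nonneg_left (rpow_le_weight hξ0).2.2.2 hA0))
      ring
    refine b.trans (ENNReal.ofReal_le_ofReal ?_)
    have h1 : 0 ≤ √ν * (C * N) := hA0
    have h2 : 0 ≤ √ν * (C * N) * I := by positivity
    rw [hA]
    linarith
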